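/- Let $\mathcal G$ be the infinite hexagonal (honeycomb) metric graph in the plane, all of whose edges have the same length $\ell>0$. Let $H^1(\mathcal G)$ be the space of continuous functions $u$ on $\mathcal G$ (real-valued, or complex-valued) such that $u$ and its weak derivative $u'$ along the edges are square-integrable over $\mathcal G$. For $p>2$ and $u\in H^1(\mathcal G)$ put $$E(u,\mathcal G)=\frac12\int_{\mathcal G}|u'|^2\,dx-\frac1p\int_{\mathcal G}|u|^p\,dx .$$ A ground state of mass $\mu$ is a function $u\in H^1(\mathcal G)$ with $\int_{\mathcal G}|u|^2\,dx=\mu$ such that $E(u,\mathcal G)\le E(v,\mathcal G)$ for every $v\in H^1(\mathcal G)$ with $\int_{\mathcal G}|v|^2\,dx=\mu$. **Theorem.** Let $2<p<4$. Then, for every $\mu>0$, there exists a ground state of mass $\mu$ (among real-valued functions as well as among complex-valued ones). -/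

import Mathlib

open MeasureTheory Set
open scoped ContDiff

noncomputable section

namespace NLSGraph

/-- A metric graph: vertices `V`, edges `E`; the edge `e` is identified with the interval
`[0, len e]`, its coordinate running from the vertex `src e` to the vertex `tgt e`. -/
structure MetricGraph where
  V : Type
  E : Type
  src : E → V
  tgt : E → V
  len : E → ℝ
  len_pos : ∀ e, 0 < len e

/-- The honeycomb with all edges of length `ℓ`.

Its vertices form two classes: `(i, j, false)` sits at `i • a₁ + j • a₂` and `(i, j, true)` at
`i • a₁ + j • a₂ + (a₁ + a₂) / 3`, where `a₁`, `a₂` are plane vectors of equal length at an angle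
of 60 degrees. The edge `(i, j, k)` joins `(i, j, false)` to its `k`-th nearest neighbour, these
being `(i, j, true)`, `(i - 1, j, true)` and `(i, j - 1, true)`. -/
abbrev honeycomb (ℓ : ℝ) (hℓ : 0 < ℓ) : MetricGraph where
  V := ℤ × ℤ × Bool
  E := ℤ × ℤ × Fin 3
  src := fun e => (e.1, e.2.1, false)
  tgt := fun e =>
    ((![e.1, e.1 - 1, e.1] : Fin 3 → ℤ) e.2.2, (![e.2.1, e.2.1, e.2.1 - 1] : Fin 3 → ℤ) e.2.2, true)
  len := fun _ => ℓ
  len_pos := fun _ => hℓ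

section Weak

variable {F : Type*} [NormedAddCommGroup F] [NormedSpace ℝ F]

/-- `g` is a weak derivative of `f` on the interval `(0, ℓ)`. -/
structure IsWeakDeriv (ℓ : ℝ) (f g : ℝ → F) : Prop where
  locallyIntegrable : LocallyIntegrableOn f (Ioo 0 ℓ)
  locallyIntegrable_deriv : LocallyIntegrableOn g (Ioo 0 ℓ)
  integral_eq : ∀ φ : ℝ → ℝ, ContDiff ℝ ∞ φ → HasCompactSupport φ → tsupport φ ⊆ Ioo 0 ℓ →
    ∫ x in Ioo 0 ℓ, deriv φ x • f x = -∫ x in Ioo 0 ℓ, φ x • g x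

open Classical in
/-- The weak derivative of `f` on `(0, ℓ)`, unique up to null sets (and `0` if there is none). -/
def weakDeriv (ℓ : ℝ) (f : ℝ → F) : ℝ → F :=
  if h : ∃ g, IsWeakDeriv ℓ f g then h.choose else 0

theorem isWeakDeriv_weakDeriv {ℓ : ℝ} {f g : ℝ → F} (h : IsWeakDeriv ℓ f g) :
    IsWeakDeriv ℓ f (weakDeriv ℓ f) := by
  have hex : ∃ g, IsWeakDeriv ℓ f g := ⟨g, h⟩
  rw [weakDeriv, dif_pos hex]
  exact hex.choose_spec

/-- Weak derivatives are unique up to null sets. -/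
theorem IsWeakDeriv.ae_eq [CompleteSpace F] {ℓ : ℝ} {f g₁ g₂ : ℝ → F}
    (h₁ : IsWeakDeriv ℓ f g₁) (h₂ : IsWeakDeriv ℓ f g₂) :
    g₁ =ᵐ[volume.restrict (Ioo 0 ℓ)] g₂ := by
  have key : ∀ᵐ x, x ∈ Ioo 0 ℓ → (g₁ - g₂) x = 0 := by
    refine isOpen_Ioo.ae_eq_zero_of_integral_contDiff_smul_eq_zero
      (h₁.locallyIntegrable_deriv.sub h₂.locallyIntegrable_deriv) fun φ hφ hc hs => ?_
    have int : ∀ {g : ℝ → F}, LocallyIntegrableOn g (Ioo 0 ℓ) →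
        Integrable (fun x => φ x • g x) := fun {g} hg => by
      have h : IntegrableOn (fun x => φ x • g x) (tsupport φ) :=
        (hg.integrableOn_compact_subset hs hc).continuousOn_smul hφ.continuous.continuousOn hc
      refine (integrableOn_iff_integrable_of_support_subset fun x hx => ?_).mp h
      by_contra hx'
      exact hx (by simp only [image_eq_zero_of_notMem_tsupport hx', zero_smul])
    have out : ∀ g : ℝ → F, ∫ x in Ioo 0 ℓ, φ x • g x = ∫ x, φ x • g x := fun g => by
      refine setIntegral_eq_integral_of_forall_compl_eq_zero fun x hx => ?_
      rw [image_eq_zero_of_notMem_tsupport fun hx' => hx (hs hx'), zero_smul]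
    have e : ∫ x, φ x • g₁ x = ∫ x, φ x • g₂ x := by
      rw [← out, ← out]
      exact neg_injective ((h₁.integral_eq φ hφ hc hs).symm.trans (h₂.integral_eq φ hφ hc hs))
    simp only [Pi.sub_apply, smul_sub]
    rw [integral_sub (int h₁.locallyIntegrable_deriv) (int h₂.locallyIntegrable_deriv), e, sub_self]
  rw [Filter.EventuallyEq, ae_restrict_iff' measurableSet_Ioo]
  filter_upwards [key] with x hx hx'
  exact sub_eq_zero.mp (hx hx')

end Weak

namespace MetricGraph

variable (G : MetricGraph) {𝕜 : Type*} [RCLike 𝕜]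

/-- The integral over `G` of the function given on each edge `e` by `f e`. -/
def integral (f : G.E → ℝ → ℝ) : ℝ :=
  ∑' e, ∫ x in Ioo 0 (G.len e), f e x

/-- Membership in `H¹(G)`. A function on `G` is a family `u` of functions, one on each edge, of
which only the values `u e x` with `0 ≤ x ≤ len e` matter; it is in `H¹(G)` if it is continuous
on `G` (on each edge and at the vertices), and both `u` and its weak derivative are
square-integrable over `G`. -/
structure MemH1 (u : G.E → ℝ → 𝕜) : Prop where
  continuousOn : ∀ e, ContinuousOn (u e) (Icc 0 (G.len e))
  vertex : ∃ w : G.V → 𝕜, ∀ e, u e 0 = w (G.src e) ∧ u e (G.len e) = w (G.tgt e)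
  weak : ∀ e, IsWeakDeriv (G.len e) (u e) (weakDeriv (G.len e) (u e))
  memLp : ∀ e, MemLp (u e) 2 (volume.restrict (Ioo 0 (G.len e)))
  memLp_deriv : ∀ e, MemLp (weakDeriv (G.len e) (u e)) 2 (volume.restrict (Ioo 0 (G.len e)))
  summable : Summable fun e => ∫ x in Ioo 0 (G.len e), ‖u e x‖ ^ 2
  summable_deriv :
    Summable fun e => ∫ x in Ioo 0 (G.len e), ‖weakDeriv (G.len e) (u e) x‖ ^ 2

/-- The mass `∫_G |u|²`. -/
def mass (u : G.E → ℝ → 𝕜) : ℝ :=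
  G.integral fun e x => ‖u e x‖ ^ 2

/-- The NLS energy `E(u, G) = 1/2 ∫_G |u'|² - 1/p ∫_G |u|^p`. -/
def energy (p : ℝ) (u : G.E → ℝ → 𝕜) : ℝ :=
  1 / 2 * (G.integral fun e x => ‖weakDeriv (G.len e) (u e) x‖ ^ 2) -
    1 / p * (G.integral fun e x => ‖u e x‖ ^ p)

/-- `u` is a ground state of mass `μ`: it minimizes the energy among all functions in `H¹(G)` of
mass `μ`. -/
def IsGroundState (p μ : ℝ) (u : G.E → ℝ → 𝕜) : Prop :=
  (G.MemH1 u ∧ G.mass u = μ) ∧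
    ∀ v : G.E → ℝ → 𝕜, G.MemH1 v → G.mass v = μ → G.energy p u ≤ G.energy p v

end MetricGraph

end NLSGraph

end

/-!
Ground states are obtained by the direct method of the calculus of variations; what has to be
excluded is that a minimizing sequence spreads out over the honeycomb or escapes to infinity.

Spreading out is excluded by the sign of the infimum. Since `p < 4 = 2 + 4 / d` with `d = 2`, a tent
function on a large square, scaled to mass `μ`, has negative energy (`exists_energy_neg`): on a
square of side `M` its kinetic energy is of order `M⁻²` and its potential energy of order `M²⁻ᵖ`.
Hence the infimum `I` of the energy at mass `μ` is negative, and it is finite because the energy is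
coercive (`exists_le_energy`), by the Sobolev inequality on each edge. A function whose energy is
close to `I < 0` cannot be uniformly small, because `∫ |u|^p ≤ (sup |u|)^(p - 2) μ`. Escape to
infinity is excluded by translation: every edge can be moved to one of the three at the origin
(`exists_translation`), so a minimizing sequence `uₙ` may be taken to be large near the origin.

Such a sequence has a nonzero weak limit `w`, uniform on each edge, and subtracting `w` from `uₙ`
removes, in the limit, exactly the mass and the energy of `w` (`GraphH1.exists_limit`, a form of the
Brezis–Lieb lemma). Limits are taken along an ultrafilter, so that no subsequences are needed.
Let `0 < m ≤ μ` be the mass of `w`. As `p > 2`, multiplying the mass by `θ ≥ 1` multiplies the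
energy by at most `θ` (`GraphH1.energy_sqrt_mul_le`); so the remainder `uₙ - w`, of mass about
`μ - m`, has energy at least about `(μ - m) / μ * I`. What is left for `w` is an energy of at most
`m / μ * I`, and by the same scaling `w`, multiplied up to mass `μ`, has energy at most `I`. It is
a ground state, whether or not mass has been lost in the limit.
-/

noncomputable section

namespace NLSGraph

open Filter Topology

/-! ### Weak derivatives and primitives -/

section OneDim
variable {F : Type*} [NormedAddCommGroup F] [NormedSpace ℝ F]

/-- Integration by parts against a test function, for the primitive of an integrable function. -/
theorem integral_deriv_smul_primitive {ℓ : ℝ} {g : ℝ → F} [CompleteSpace F]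
    (hg : IntegrableOn g (Ioo 0 ℓ))
    {φ : ℝ → ℝ} (hφ : ContDiff ℝ ∞ φ) (hc : HasCompactSupport φ) (hs : tsupport φ ⊆ Ioo 0 ℓ) :
    ∫ x in Ioo 0 ℓ, deriv φ x • (∫ t in (0 : ℝ)..x, g t) = -∫ x in Ioo 0 ℓ, φ x • g x := by
  set I := Ioo (0 : ℝ) ℓ with hI
  have hφ' : Continuous (deriv φ) := hφ.continuous_deriv (by simp)
  have hφ'I : IntegrableOn (deriv φ) I :=
    (hφ'.integrable_of_hasCompactSupport hc.deriv).integrableOn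
  have hprod : Integrable (fun z : ℝ × ℝ => {z : ℝ × ℝ | z.2 ≤ z.1}.indicator
      (fun z => deriv φ z.1 • g z.2) z) ((volume.restrict I).prod (volume.restrict I)) :=
    (hφ'I.smul_prod hg).indicator (measurableSet_le measurable_snd measurable_fst)
  have e1 : ∀ x ∈ I, deriv φ x • (∫ t in (0 : ℝ)..x, g t) =
      ∫ t in I, {z : ℝ × ℝ | z.2 ≤ z.1}.indicator (fun z => deriv φ z.1 • g z.2) (x, t) := by
    intro x hx
    have h1 : (fun t => {z : ℝ × ℝ | z.2 ≤ z.1}.indicator (fun z => deriv φ z.1 • g z.2) (x, t)) =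
        (Iic x).indicator (fun t => deriv φ x • g t) := by
      ext t; simp [indicator]
    rw [h1, setIntegral_indicator measurableSet_Iic, integral_smul,
      intervalIntegral.integral_of_le hx.1.le]
    congr 3
    ext t
    simp only [hI, mem_Ioc, mem_inter_iff, mem_Ioo, mem_Iic]
    exact ⟨fun h => ⟨⟨h.1, h.2.trans_lt hx.2⟩, h.2⟩, fun h => ⟨h.1.1, h.2⟩⟩
  have hφℓ : φ ℓ = 0 := image_eq_zero_of_notMem_tsupport fun h => (hs h).2.ne rfl
  have e2 : ∀ t ∈ I, (∫ x in I, {z : ℝ × ℝ | z.2 ≤ z.1}.indicator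
      (fun z => deriv φ z.1 • g z.2) (x, t)) = -(φ t • g t) := by
    intro t ht
    have h1 : (fun x => {z : ℝ × ℝ | z.2 ≤ z.1}.indicator (fun z => deriv φ z.1 • g z.2) (x, t)) =
        (Ici t).indicator (fun x => deriv φ x • g t) := by
      ext x; simp [indicator]
    have h2 : I ∩ Ici t = Ico t ℓ := by
      ext x
      simp only [hI, mem_Ico, mem_inter_iff, mem_Ioo, mem_Ici]
      exact ⟨fun h => ⟨h.2, h.1.2⟩, fun h => ⟨⟨ht.1.trans_le h.1, h.2⟩, h.1⟩⟩
    rw [h1, setIntegral_indicator measurableSet_Ici, integral_smul_const, h2,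
      integral_Ico_eq_integral_Ioc, ← intervalIntegral.integral_of_le ht.2.le,
      intervalIntegral.integral_deriv_eq_sub
        (fun x _ => (hφ.differentiable (by simp)).differentiableAt)
        (hφ'.intervalIntegrable _ _), hφℓ, zero_sub, neg_smul]
  rw [setIntegral_congr_fun measurableSet_Ioo e1, integral_integral_swap hprod,
    setIntegral_congr_fun measurableSet_Ioo e2, integral_neg]

/-- A test function on `(0, ℓ)` of integral `0` is the derivative of a test function. -/
theorem exists_deriv_eq_of_integral_eq_zero {ℓ : ℝ} {ψ : ℝ → ℝ} (hψ : ContDiff ℝ ∞ ψ)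
    (hc : HasCompactSupport ψ) (hs : tsupport ψ ⊆ Ioo 0 ℓ) (h0 : ∫ x, ψ x = 0) :
    ∃ φ : ℝ → ℝ, ContDiff ℝ ∞ φ ∧ HasCompactSupport φ ∧ tsupport φ ⊆ Ioo 0 ℓ ∧ deriv φ = ψ := by
  by_cases hne : (tsupport ψ).Nonempty
  swap
  · have hz : ψ = 0 := tsupport_eq_empty_iff.mp (not_nonempty_iff_eq_empty.mp hne)
    exact ⟨0, contDiff_const, HasCompactSupport.zero, by simp [tsupport], by simp [hz]⟩
  obtain ⟨a, ha, ha'⟩ := hc.isCompact.exists_isLeast hne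
  obtain ⟨b, hb, hb'⟩ := hc.isCompact.exists_isGreatest hne
  have hint : Integrable ψ := hψ.continuous.integrable_of_hasCompactSupport hc
  have hd : ∀ x, HasDerivAt (fun x => ∫ t in a..x, ψ t) (ψ x) x := fun x =>
    intervalIntegral.integral_hasDerivAt_right (hψ.continuous.intervalIntegrable _ _)
      (hψ.continuous.stronglyMeasurableAtFilter _ _) hψ.continuous.continuousAt
  have hderiv : deriv (fun x => ∫ t in a..x, ψ t) = ψ := funext fun x => (hd x).deriv
  have hout : ∀ x, x ∉ Icc a b → ψ x = 0 := fun x hx =>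
    image_eq_zero_of_notMem_tsupport fun h => hx ⟨ha' h, hb' h⟩
  have htot : ∫ t in a..b, ψ t = 0 := by
    rw [intervalIntegral.integral_of_le (ha' hb), ← integral_Icc_eq_integral_Ioc,
      setIntegral_eq_integral_of_forall_compl_eq_zero hout, h0]
  have hzero : ∀ x, x ∉ Icc a b → ∫ t in a..x, ψ t = 0 := by
    intro x hx
    rcases lt_or_ge x a with h | h
    · refine (intervalIntegral.integral_congr_ae ?_).trans intervalIntegral.integral_zero
      have hne : ∀ᵐ t : ℝ, t ≠ a := by simp [ae_iff]
      filter_upwards [hne] with t hta ht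
      rw [uIoc_of_ge h.le] at ht
      exact hout t fun h' => hta (le_antisymm ht.2 h'.1)
    · have hbx : b < x := lt_of_not_ge fun h' => hx ⟨h, h'⟩
      rw [← intervalIntegral.integral_add_adjacent_intervals
        (hψ.continuous.intervalIntegrable a b) (hψ.continuous.intervalIntegrable b x), htot,
        zero_add]
      refine (intervalIntegral.integral_congr_ae ?_).trans intervalIntegral.integral_zero
      refine Filter.Eventually.of_forall fun t ht => ?_
      rw [uIoc_of_le hbx.le] at ht
      exact hout t fun h' => absurd h'.2 (not_le.mpr ht.1)
  have hsub : tsupport (fun x => ∫ t in a..x, ψ t) ⊆ Icc a b :=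
    closure_minimal (fun x hx => by by_contra h; exact hx (hzero x h)) isClosed_Icc
  refine ⟨fun x => ∫ t in a..x, ψ t, ?_, HasCompactSupport.intro isCompact_Icc hzero,
    hsub.trans fun x hx => ⟨(hs ha).1.trans_le hx.1, hx.2.trans_lt (hs hb).2⟩, hderiv⟩
  rw [contDiff_infty_iff_deriv, hderiv]
  exact ⟨fun x => (hd x).differentiableAt, hψ⟩

/-- The du Bois-Reymond lemma: a function whose weak derivative vanishes is constant. -/
theorem ae_eq_const_of_integral_deriv_smul_eq_zero {ℓ : ℝ} (hℓ : 0 < ℓ) {h : ℝ → F}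
    [CompleteSpace F] (hh : LocallyIntegrableOn h (Ioo 0 ℓ))
    (h0 : ∀ φ : ℝ → ℝ, ContDiff ℝ ∞ φ → HasCompactSupport φ → tsupport φ ⊆ Ioo 0 ℓ →
      ∫ x in Ioo 0 ℓ, deriv φ x • h x = 0) :
    ∃ c, ∀ᵐ x, x ∈ Ioo 0 ℓ → h x = c := by
  -- Subtracting from a test function `ψ` the multiple `(∫ ψ) ψ₀` makes its integral vanish, so that
  -- it is a derivative; this identifies the constant as `∫ ψ₀ h`.
  let B : ContDiffBump (ℓ / 2) := ⟨ℓ / 8, ℓ / 4, by positivity, by linarith⟩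
  let ψ₀ : ℝ → ℝ := B.normed volume
  have hψ₀ : ContDiff ℝ ∞ ψ₀ := B.contDiff_normed
  have hc₀ : HasCompactSupport ψ₀ := B.hasCompactSupport_normed
  have hs₀ : tsupport ψ₀ ⊆ Ioo 0 ℓ := by
    rw [B.tsupport_normed_eq, Real.closedBall_eq_Icc]
    intro x hx
    have h1 : B.rOut = ℓ / 4 := rfl
    rw [h1] at hx
    exact ⟨by linarith [hx.1], by linarith [hx.2]⟩
  have hi₀ : ∫ x, ψ₀ x = 1 := B.integral_normed
  have int : ∀ {φ : ℝ → ℝ} {k : ℝ → F}, LocallyIntegrableOn k (Ioo 0 ℓ) → Continuous φ →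
      HasCompactSupport φ → tsupport φ ⊆ Ioo 0 ℓ → Integrable (fun x => φ x • k x) :=
    fun {φ k} hk hφ hc hs => by
      have h : IntegrableOn (fun x => φ x • k x) (tsupport φ) :=
        (hk.integrableOn_compact_subset hs hc).continuousOn_smul hφ.continuousOn hc
      refine (integrableOn_iff_integrable_of_support_subset fun x hx => ?_).mp h
      by_contra hx'
      exact hx (by simp only [image_eq_zero_of_notMem_tsupport hx', zero_smul])
  have out : ∀ {φ : ℝ → ℝ} (k : ℝ → F), tsupport φ ⊆ Ioo 0 ℓ →
      ∫ x in Ioo 0 ℓ, φ x • k x = ∫ x, φ x • k x := fun {φ} k hs => by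
    refine setIntegral_eq_integral_of_forall_compl_eq_zero fun x hx => ?_
    rw [image_eq_zero_of_notMem_tsupport fun hx' => hx (hs hx'), zero_smul]
  have hconst : LocallyIntegrableOn (fun _ : ℝ => ∫ x, ψ₀ x • h x) (Ioo 0 ℓ) :=
    (locallyIntegrable_const _).locallyIntegrableOn _
  refine ⟨∫ x, ψ₀ x • h x, ?_⟩
  have key := isOpen_Ioo.ae_eq_zero_of_integral_contDiff_smul_eq_zero (hh.sub hconst)
    fun ψ hψ hc hs => ?_
  · filter_upwards [key] with x hx hx'
    exact sub_eq_zero.mp (hx hx')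
  set c : ℝ := ∫ x, ψ x with hcdef
  have hs' : tsupport (fun x => ψ x - c * ψ₀ x) ⊆ Ioo 0 ℓ :=
    (tsupport_sub ψ fun x => c * ψ₀ x).trans
      (union_subset hs ((tsupport_mul_subset_right (f := fun _ => c) (g := ψ₀)).trans hs₀))
  obtain ⟨φ, hφ, hφc, hφs, hd⟩ := exists_deriv_eq_of_integral_eq_zero (ℓ := ℓ)
    (ψ := fun x => ψ x - c * ψ₀ x) (hψ.sub (contDiff_const.mul hψ₀))
    (hc.sub (hc₀.mul_left)) hs' (by
      rw [integral_sub (hψ.continuous.integrable_of_hasCompactSupport hc)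
        ((hψ₀.continuous.integrable_of_hasCompactSupport hc₀).const_mul c),
        integral_const_mul, hi₀, mul_one, sub_self])
  have := h0 φ hφ hφc hφs
  rw [hd, out h hs'] at this
  have hi₁ : Integrable fun x => c • ψ₀ x • h x := (int hh hψ₀.continuous hc₀ hs₀).smul c
  simp only [sub_smul, mul_smul] at this
  rw [integral_sub (int hh hψ.continuous hc hs) hi₁, integral_smul] at this
  simp only [Pi.sub_apply, smul_sub]
  rw [integral_sub (int hh hψ.continuous hc hs) (int hconst hψ.continuous hc hs),
    integral_smul_const]
  exact this

end OneDim

/-! ### The space `H¹` of an interval -/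

section Edge
variable {𝕜 : Type*} [RCLike 𝕜]

/-- The restriction of Lebesgue measure to the interval `(0, ℓ)`, which carries an edge of length
`ℓ`. -/
abbrev edgeMeasure (ℓ : ℝ) : Measure ℝ := volume.restrict (Ioo 0 ℓ)

theorem norm_toLp_sq {α : Type*} {m : MeasurableSpace α} {ν : Measure α} {g : α → 𝕜}
    (hg : MemLp g 2 ν) : ‖hg.toLp g‖ ^ 2 = ∫ x, ‖g x‖ ^ 2 ∂ν := by
  have h : ((‖hg.toLp g‖ ^ 2 : ℝ) : 𝕜) = ((∫ x, ‖g x‖ ^ 2 ∂ν : ℝ) : 𝕜) := by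
    rw [RCLike.ofReal_pow, ← inner_self_eq_norm_sq_to_K (𝕜 := 𝕜), L2.inner_def, ← integral_ofReal]
    refine integral_congr_ae ?_
    filter_upwards [hg.coeFn_toLp] with x hx
    rw [hx, inner_self_eq_norm_sq_to_K, RCLike.ofReal_pow]
  exact_mod_cast h

/-- `u` belongs to `H¹(0, ℓ)`, with derivative `g`: it is, on `[0, ℓ]`, a primitive of the
square-integrable function `g`. The values of `u` outside `[0, ℓ]` are irrelevant. -/
structure EdgeH1 (ℓ : ℝ) (u g : ℝ → 𝕜) : Prop where
  memLp : MemLp g 2 (edgeMeasure ℓ)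
  eq_primitive : ∀ x ∈ Icc 0 ℓ, u x = u 0 + ∫ t in (0 : ℝ)..x, g t

theorem intervalIntegrable_of_memLp {ℓ : ℝ} {g : ℝ → 𝕜} (hg : MemLp g 2 (edgeMeasure ℓ))
    {x y : ℝ} (hx : x ∈ Icc 0 ℓ) (hy : y ∈ Icc 0 ℓ) : IntervalIntegrable g volume x y := by
  have h : IntegrableOn g (Icc 0 ℓ) := by
    rw [integrableOn_Icc_iff_integrableOn_Ioo]
    exact hg.integrable (by norm_num)
  exact (h.mono_set (uIcc_subset_Icc hx hy)).intervalIntegrable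

namespace EdgeH1
variable {ℓ : ℝ} {u v g k : ℝ → 𝕜}

theorem sub_eq (h : EdgeH1 ℓ u g) {x y : ℝ} (hx : x ∈ Icc 0 ℓ) (hy : y ∈ Icc 0 ℓ) :
    u y - u x = ∫ t in x..y, g t := by
  have h0 : (0 : ℝ) ∈ Icc 0 ℓ := ⟨le_rfl, hx.1.trans hx.2⟩
  rw [h.eq_primitive y hy, h.eq_primitive x hx, add_sub_add_left_eq_sub,
    intervalIntegral.integral_interval_sub_left (intervalIntegrable_of_memLp h.memLp h0 hy)
      (intervalIntegrable_of_memLp h.memLp h0 hx)]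

/-- Morrey's inequality on an interval. -/
theorem norm_sub_le (h : EdgeH1 ℓ u g) {x y : ℝ} (hx : x ∈ Icc 0 ℓ) (hy : y ∈ Icc 0 ℓ) :
    ‖u y - u x‖ ≤ √|y - x| * √(∫ t in Ioo 0 ℓ, ‖g t‖ ^ 2) := by
  wlog hxy : x ≤ y generalizing x y
  · rw [norm_sub_rev, abs_sub_comm]; exact this hy hx (le_of_not_ge hxy)
  have hμ : edgeMeasure ℓ (Ioo x y) ≠ ⊤ := (measure_lt_top _ _).ne
  have h1 := L2.inner_indicatorConstLp_one (𝕜 := 𝕜) (measurableSet_Ioo (a := x) (b := y)) hμ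
    (h.memLp.toLp g)
  have h2 : (edgeMeasure ℓ).restrict (Ioo x y) = volume.restrict (Ioo x y) := by
    rw [Measure.restrict_restrict measurableSet_Ioo,
      inter_eq_left.mpr (Ioo_subset_Ioo hx.1 hy.2)]
  have h3 : ∫ t in Ioo x y, h.memLp.toLp g t ∂(edgeMeasure ℓ) = u y - u x := by
    rw [h.sub_eq hx hy, intervalIntegral.integral_of_le hxy, integral_Ioc_eq_integral_Ioo, ← h2]
    exact integral_congr_ae (ae_restrict_of_ae h.memLp.coeFn_toLp)
  rw [← h3, ← h1]
  refine (norm_inner_le_norm _ _).trans ?_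
  gcongr
  · rw [norm_indicatorConstLp (by norm_num) (by norm_num), norm_one, one_mul, measureReal_def,
      ← Measure.restrict_apply_univ (Ioo x y), h2, Measure.restrict_apply_univ, Real.volume_Ioo,
      ENNReal.toReal_ofReal (sub_nonneg.mpr hxy), abs_of_nonneg (sub_nonneg.mpr hxy),
      Real.sqrt_eq_rpow]
    norm_num
  · rw [← norm_toLp_sq h.memLp, Real.sqrt_sq (norm_nonneg _)]

theorem continuousOn (h : EdgeH1 ℓ u g) : ContinuousOn u (Icc 0 ℓ) := by
  intro x hx
  rw [ContinuousWithinAt, tendsto_iff_norm_sub_tendsto_zero]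
  have hc : Continuous fun y : ℝ => √|y - x| * √(∫ t in Ioo 0 ℓ, ‖g t‖ ^ 2) := by fun_prop
  have h0 := (hc.tendsto x).mono_left (nhdsWithin_le_nhds (s := Icc 0 ℓ))
  simp only [sub_self, abs_zero, Real.sqrt_zero, zero_mul] at h0
  refine squeeze_zero' (Filter.Eventually.of_forall fun _ => norm_nonneg _) ?_ h0
  filter_upwards [self_mem_nhdsWithin] with y hy using h.norm_sub_le hx hy

theorem isWeakDeriv (h : EdgeH1 ℓ u g) : IsWeakDeriv ℓ u g := by
  have hg : IntegrableOn g (Ioo 0 ℓ) := h.memLp.integrable (by norm_num)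
  have hu : IntegrableOn u (Ioo 0 ℓ) :=
    (h.continuousOn.integrableOn_compact isCompact_Icc).mono_set Ioo_subset_Icc_self
  refine ⟨hu.locallyIntegrableOn, hg.locallyIntegrableOn, fun φ hφ hc hs => ?_⟩
  have hφ' : Continuous (deriv φ) := hφ.continuous_deriv (by simp)
  have hφ'I : IntegrableOn (deriv φ) (Ioo 0 ℓ) :=
    (hφ'.integrable_of_hasCompactSupport hc.deriv).integrableOn
  have h0 : ∫ x in Ioo 0 ℓ, deriv φ x = 0 := by
    rw [setIntegral_eq_integral_of_forall_compl_eq_zero]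
    · exact integral_eq_zero_of_hasDerivAt_of_integrable
        (fun x => (hφ.differentiable (by simp) x).hasDerivAt)
        (hφ'.integrable_of_hasCompactSupport hc.deriv)
        (hφ.continuous.integrable_of_hasCompactSupport hc)
    · intro x hx
      exact image_eq_zero_of_notMem_tsupport fun hx' => hx (hs (tsupport_deriv_subset hx'))
  have hi : IntegrableOn (fun x => deriv φ x • ∫ t in (0 : ℝ)..x, g t) (Ioo 0 ℓ) := by
    have h1 : IntegrableOn (fun x => deriv φ x • (u x - u 0)) (Icc 0 ℓ) :=
      (hφ'.continuousOn.smul (h.continuousOn.sub continuousOn_const)).integrableOn_compact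
        isCompact_Icc
    refine (h1.mono_set Ioo_subset_Icc_self).congr_fun (fun x hx => ?_) measurableSet_Ioo
    simp only
    rw [h.eq_primitive x (Ioo_subset_Icc_self hx), add_sub_cancel_left]
  rw [← integral_deriv_smul_primitive hg hφ hc hs]
  calc ∫ x in Ioo 0 ℓ, deriv φ x • u x
      = ∫ x in Ioo 0 ℓ, (deriv φ x • u 0 + deriv φ x • ∫ t in (0 : ℝ)..x, g t) := by
        refine setIntegral_congr_fun measurableSet_Ioo fun x hx => ?_
        rw [h.eq_primitive x (Ioo_subset_Icc_self hx), smul_add]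
    _ = _ := by
        rw [integral_add (hφ'I.smul_const _) hi, integral_smul_const, h0, zero_smul, zero_add]

theorem of_isWeakDeriv (hℓ : 0 < ℓ) (hu : ContinuousOn u (Icc 0 ℓ)) (h : IsWeakDeriv ℓ u g)
    (hg : MemLp g 2 (edgeMeasure ℓ)) : EdgeH1 ℓ u g := by
  refine ⟨hg, ?_⟩
  have hP : EdgeH1 ℓ (fun x => ∫ t in (0 : ℝ)..x, g t) g := ⟨hg, fun x _ => by simp⟩
  have hPc := hP.continuousOn
  obtain ⟨c, hc⟩ := ae_eq_const_of_integral_deriv_smul_eq_zero hℓ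
    (h := fun x => u x - ∫ t in (0 : ℝ)..x, g t)
    (h.locallyIntegrable.sub hP.isWeakDeriv.locallyIntegrable) fun φ hφ hc hs => by
      have hφ' : Continuous (deriv φ) := hφ.continuous_deriv (by simp)
      have i1 : IntegrableOn (fun x => deriv φ x • u x) (Ioo 0 ℓ) :=
        ((hφ'.continuousOn.smul hu).integrableOn_compact isCompact_Icc).mono_set
          Ioo_subset_Icc_self
      have i2 : IntegrableOn (fun x => deriv φ x • ∫ t in (0 : ℝ)..x, g t) (Ioo 0 ℓ) :=
        ((hφ'.continuousOn.smul hPc).integrableOn_compact isCompact_Icc).mono_set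
          Ioo_subset_Icc_self
      simp only [smul_sub]
      rw [integral_sub i1 i2, h.integral_eq φ hφ hc hs, hP.isWeakDeriv.integral_eq φ hφ hc hs,
        sub_self]
  -- The two sides are continuous on `[0, ℓ]`, so equality almost everywhere is equality.
  have heq : EqOn (fun x => u x - ∫ t in (0 : ℝ)..x, g t) (fun _ => c) (Icc 0 ℓ) := by
    have h1 : EqOn (fun x => u x - ∫ t in (0 : ℝ)..x, g t) (fun _ => c) (Ioo 0 ℓ) := by
      refine Measure.eqOn_open_of_ae_eq (μ := volume) ?_ isOpen_Ioo
        ((hu.sub hPc).mono Ioo_subset_Icc_self) continuousOn_const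
      rw [Filter.EventuallyEq, ae_restrict_iff' measurableSet_Ioo]
      exact hc
    exact h1.of_subset_closure (hu.sub hPc) continuousOn_const Ioo_subset_Icc_self
      (by rw [closure_Ioo hℓ.ne])
  intro x hx
  have hx1 := heq hx
  have h01 := heq (left_mem_Icc.mpr hℓ.le)
  simp only [intervalIntegral.integral_same, sub_zero] at hx1 h01
  rw [h01, ← hx1, sub_add_cancel]

theorem sub (hℓ : 0 ≤ ℓ) (hu : EdgeH1 ℓ u g) (hv : EdgeH1 ℓ v k) :
    EdgeH1 ℓ (fun x => u x - v x) (fun x => g x - k x) := by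
  refine ⟨hu.memLp.sub hv.memLp, fun x hx => ?_⟩
  have h0 : (0 : ℝ) ∈ Icc 0 ℓ := ⟨le_rfl, hℓ⟩
  rw [intervalIntegral.integral_sub (intervalIntegrable_of_memLp hu.memLp h0 hx)
    (intervalIntegrable_of_memLp hv.memLp h0 hx), hu.eq_primitive x hx, hv.eq_primitive x hx]
  ring

theorem const_mul (c : 𝕜) (hu : EdgeH1 ℓ u g) :
    EdgeH1 ℓ (fun x => c * u x) (fun x => c * g x) := by
  refine ⟨hu.memLp.const_mul c, fun x hx => ?_⟩
  rw [intervalIntegral.integral_const_mul, hu.eq_primitive x hx, mul_add]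

theorem integrableOn_sq (hu : EdgeH1 ℓ u g) : IntegrableOn (fun x => ‖u x‖ ^ 2) (Ioo 0 ℓ) :=
  ((hu.continuousOn.norm.pow 2).integrableOn_compact isCompact_Icc).mono_set Ioo_subset_Icc_self

theorem integrableOn_rpow {p : ℝ} (hp : 0 ≤ p) (h : EdgeH1 ℓ u g) :
    IntegrableOn (fun x => ‖u x‖ ^ p) (Ioo 0 ℓ) :=
  ((h.continuousOn.norm.rpow_const fun _ _ => Or.inr hp).integrableOn_compact
    isCompact_Icc).mono_set Ioo_subset_Icc_self

theorem memLp_self (h : EdgeH1 ℓ u g) : MemLp u 2 (edgeMeasure ℓ) := by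
  have hm : AEStronglyMeasurable u (edgeMeasure ℓ) :=
    (h.continuousOn.mono Ioo_subset_Icc_self).aestronglyMeasurable measurableSet_Ioo
  exact (memLp_two_iff_integrable_sq_norm hm).mpr h.integrableOn_sq

/-- The Sobolev inequality on an interval. -/
theorem norm_le (hℓ : 0 < ℓ) (hu : EdgeH1 ℓ u g) {x : ℝ} (hx : x ∈ Icc 0 ℓ) :
    ‖u x‖ ≤ √((∫ t in Ioo 0 ℓ, ‖u t‖ ^ 2) / ℓ) + √ℓ * √(∫ t in Ioo 0 ℓ, ‖g t‖ ^ 2) := by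
  -- At a minimum point of `‖u‖` its square is at most the mean value of `‖u‖²`.
  obtain ⟨y, hy, hmin⟩ := isCompact_Icc.exists_isMinOn (nonempty_Icc.mpr hℓ.le)
    hu.continuousOn.norm
  have h1 : ‖u y‖ ≤ √((∫ t in Ioo 0 ℓ, ‖u t‖ ^ 2) / ℓ) := by
    refine Real.le_sqrt_of_sq_le ?_
    rw [le_div_iff₀ hℓ]
    calc ‖u y‖ ^ 2 * ℓ = ∫ _ in Ioo 0 ℓ, ‖u y‖ ^ 2 := by
          rw [setIntegral_const, smul_eq_mul, measureReal_def, Real.volume_Ioo, sub_zero,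
            ENNReal.toReal_ofReal hℓ.le, mul_comm]
      _ ≤ _ := by
          refine setIntegral_mono_on (integrableOn_const (by simp)) hu.integrableOn_sq
            measurableSet_Ioo fun t ht => ?_
          have := hmin (Ioo_subset_Icc_self ht)
          simp only [mem_ofPred_eq] at this
          gcongr
  have h2 : ‖u x - u y‖ ≤ √ℓ * √(∫ t in Ioo 0 ℓ, ‖g t‖ ^ 2) := by
    refine (hu.norm_sub_le hy hx).trans ?_
    gcongr
    exact abs_sub_le_iff.mpr ⟨by linarith [hx.2, hy.1], by linarith [hx.1, hy.2]⟩
  calc ‖u x‖ = ‖u y + (u x - u y)‖ := by rw [add_sub_cancel]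
    _ ≤ _ := (norm_add_le _ _).trans (add_le_add h1 h2)

end EdgeH1
end Edge

/-! ### Limits along filters -/

section Limits

theorem exists_tendsto_of_norm_le {ι F : Type*} [NormedAddCommGroup F] [ProperSpace F]
    (U : Ultrafilter ι) {y : ι → F} {K : ℝ} (h : ∀ i, ‖y i‖ ≤ K) :
    ∃ z, Tendsto y U (𝓝 z) := by
  obtain ⟨z, -, hz⟩ := (isCompact_closedBall (0 : F) K).ultrafilter_le_nhds (U.map y) (by
    rw [le_principal_iff]
    exact Filter.mem_map.mpr (Eventually.of_forall fun i => mem_closedBall_zero_iff.mpr (h i)))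
  exact ⟨z, hz⟩

/-- Bounded families in a Hilbert space converge weakly along an ultrafilter. -/
theorem exists_tendsto_inner_of_norm_le {ι 𝕜 H : Type*} [RCLike 𝕜] [NormedAddCommGroup H]
    [InnerProductSpace 𝕜 H] [CompleteSpace H] (U : Ultrafilter ι) {y : ι → H} {K : ℝ}
    (h : ∀ i, ‖y i‖ ≤ K) :
    ∃ z, ∀ v, Tendsto (fun i => inner 𝕜 (y i) v) U (𝓝 (inner 𝕜 z v)) := by
  let Λ : ι → WeakDual 𝕜 H := fun i => StrongDual.toWeakDual (InnerProductSpace.toDual 𝕜 H (y i))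
  have hball := WeakDual.isCompact_closedBall (𝕜 := 𝕜) (0 : StrongDual 𝕜 H) K
  obtain ⟨L, -, hL⟩ := hball.ultrafilter_le_nhds (U.map Λ) (by
      rw [le_principal_iff]
      refine Filter.mem_map.mpr (Eventually.of_forall fun i => ?_)
      simp only [mem_preimage, mem_closedBall_zero_iff, Λ]
      exact ((InnerProductSpace.toDual 𝕜 H).norm_map (y i)).trans_le (h i))
  refine ⟨(InnerProductSpace.toDual 𝕜 H).symm (WeakDual.toStrongDual L), fun v => ?_⟩
  have h1 : Tendsto (fun i => Λ i v) U (𝓝 (L v)) :=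
    ((WeakDual.eval_continuous v).tendsto L).comp hL
  rw [InnerProductSpace.toDual_symm_apply]
  exact h1

/-- Convergence of sums whose terms are dominated, up to a summable family with an arbitrarily large
constant, by an arbitrarily small multiple of terms with bounded sum. -/
theorem tendsto_tsum_of_forall_exists_abs_le {ι α : Type*} {l : Filter ι} {s A : ι → α → ℝ}
    {S B : α → ℝ} {C : ℝ} (hA0 : ∀ i e, 0 ≤ A i e) (hA : ∀ i, Summable (A i))
    (hAC : ∀ i, ∑' e, A i e ≤ C) (hB : Summable B) (hS : Summable S)
    (hs : ∀ e, Tendsto (fun i => s i e) l (𝓝 (S e)))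
    (bound : ∀ η > 0, ∃ D, ∀ i e, |s i e| ≤ η * A i e + D * B e) :
    Tendsto (fun i => ∑' e, s i e) l (𝓝 (∑' e, S e)) := by
  rw [Metric.tendsto_nhds]
  intro ε hε
  have hη : 0 < ε / (4 * (|C| + 1)) := by positivity
  obtain ⟨D, hD⟩ := bound _ hη
  set η := ε / (4 * (|C| + 1)) with hηdef
  have hηC : η * C ≤ ε / 4 := by
    have h1 : η * C ≤ η * (|C| + 1) := by gcongr; linarith [le_abs_self C]
    have h2 : η * (|C| + 1) = ε / 4 := by rw [hηdef]; field_simp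
    linarith
  have hsum : ∀ i, Summable (s i) := fun i =>
    (((hA i).mul_left η).add (hB.mul_left D)).of_norm_bounded fun e => hD i e
  have t1 := tendsto_tsum_compl_atTop_zero fun e => D * B e
  have t2 := tendsto_tsum_compl_atTop_zero S
  obtain ⟨T, hT1, hT2⟩ := ((t1.eventually (gt_mem_nhds (show (0 : ℝ) < ε / 4 by positivity))).and
    (t2.eventually (Metric.ball_mem_nhds (0 : ℝ) (show (0 : ℝ) < ε / 4 by positivity)))).exists
  have t3 : Tendsto (fun i => ∑ e ∈ T, s i e) l (𝓝 (∑ e ∈ T, S e)) :=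
    tendsto_finsetSum _ fun e _ => hs e
  filter_upwards [t3.eventually (Metric.ball_mem_nhds _ (show (0 : ℝ) < ε / 4 by positivity))]
    with i hi
  have tail : |∑' e : {e // e ∉ T}, s i e| ≤ η * C + ∑' e : {e // e ∉ T}, D * B e := by
    have hA' : Summable fun e : {e // e ∉ T} => η * A i e := ((hA i).mul_left η).subtype _
    have hB' : Summable fun e : {e // e ∉ T} => D * B e := (hB.mul_left D).subtype _
    refine (tsum_of_norm_bounded (f := fun e : {e // e ∉ T} => s i e)
      (hA'.add hB').hasSum fun e => hD i e).trans ?_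
    rw [hA'.tsum_add hB', tsum_mul_left]
    gcongr
    refine le_trans ?_ (hAC i)
    exact Summable.tsum_subtype_le (A i) _ (hA0 i) (hA i)
  rw [Real.dist_eq, ← (hsum i).sum_add_tsum_subtype_compl T, ← hS.sum_add_tsum_subtype_compl T]
  rw [Real.dist_eq] at hi hT2
  rw [sub_zero] at hT2
  rw [abs_lt] at hi hT2
  rw [abs_le] at tail
  rw [abs_lt]
  constructor <;> linarith [tail.1, tail.2, hi.1, hi.2, hT2.1, hT2.2]

end Limits

/-! ### The pointwise splitting estimate -/

section Powers

theorem abs_rpow_sub_rpow_le {s t M p : ℝ} (hp : 1 ≤ p) (hs : 0 ≤ s) (ht : 0 ≤ t) (hsM : s ≤ M)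
    (htM : t ≤ M) : |s ^ p - t ^ p| ≤ p * M ^ (p - 1) * |s - t| := by
  wlog hst : t ≤ s generalizing s t
  · rw [abs_sub_comm, abs_sub_comm s]; exact this ht hs htM hsM (le_of_not_ge hst)
  rcases hs.eq_or_lt with rfl | hs'
  · have : t = 0 := le_antisymm hst ht
    simp [this]
  rw [abs_of_nonneg (sub_nonneg.mpr hst),
    abs_of_nonneg (sub_nonneg.mpr (Real.rpow_le_rpow ht hst (by linarith)))]
  have hb := one_add_mul_self_le_rpow_one_add (s := t / s - 1)
    (by linarith [div_nonneg ht hs]) hp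
  rw [add_sub_cancel, Real.div_rpow ht hs, le_div_iff₀ (Real.rpow_pos_of_pos hs' p)] at hb
  have h1 : s ^ p = s ^ (p - 1) * s := by
    rw [← Real.rpow_add_one hs'.ne', sub_add_cancel]
  have h2 : (1 + p * (t / s - 1)) * s ^ p = s ^ p - p * s ^ (p - 1) * (s - t) := by
    rw [h1]; field_simp; ring
  have h3 : p * s ^ (p - 1) * (s - t) ≤ p * M ^ (p - 1) * (s - t) := by
    have : 0 ≤ s - t := sub_nonneg.mpr hst
    have : s ^ (p - 1) ≤ M ^ (p - 1) := Real.rpow_le_rpow hs hsM (by linarith)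
    gcongr
  linarith

/-- The pointwise estimate behind the Brezis–Lieb splitting. -/
theorem abs_norm_rpow_sub_norm_sub_rpow_le {F : Type*} [NormedAddCommGroup F] {p M η : ℝ}
    (hp : 2 ≤ p) (hη : 0 < η) {a b : F} (ha : ‖a‖ ≤ M) (hb : ‖b‖ ≤ M) :
    |‖a‖ ^ p - ‖a - b‖ ^ p| ≤
      p * (2 * M) ^ (p - 2) * (η * ‖a‖ ^ 2 + (1 / η + 1) * ‖b‖ ^ 2) := by
  have hn : ‖a - b‖ ≤ ‖a‖ + ‖b‖ := norm_sub_le a b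
  have h1 := abs_rpow_sub_rpow_le (M := ‖a‖ + ‖b‖) (p := p) (by linarith) (norm_nonneg a)
    (norm_nonneg (a - b)) (by linarith [norm_nonneg b]) hn
  have h2 : |‖a‖ - ‖a - b‖| ≤ ‖b‖ := by
    have := abs_norm_sub_norm_le a (a - b)
    rwa [sub_sub_cancel] at this
  have hab : 0 ≤ ‖a‖ + ‖b‖ := by positivity
  have h3 : (‖a‖ + ‖b‖) ^ (p - 1) ≤ (2 * M) ^ (p - 2) * (‖a‖ + ‖b‖) := by
    rcases hab.eq_or_lt with h | h
    · rw [← h, Real.zero_rpow (by linarith), mul_zero]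
    · rw [show p - 1 = (p - 2) + 1 by ring, Real.rpow_add_one h.ne']
      gcongr
      linarith
  have h4 : (‖a‖ + ‖b‖) * ‖b‖ ≤ η * ‖a‖ ^ 2 + (1 / η + 1) * ‖b‖ ^ 2 := by
    have h5 : η * ‖a‖ ^ 2 + (1 / η + 1) * ‖b‖ ^ 2 - (‖a‖ + ‖b‖) * ‖b‖ =
        1 / η * ((η * ‖a‖ - ‖b‖ / 2) ^ 2 + 3 / 4 * ‖b‖ ^ 2) := by
      field_simp; ring
    have h6 : 0 ≤ 1 / η * ((η * ‖a‖ - ‖b‖ / 2) ^ 2 + 3 / 4 * ‖b‖ ^ 2) := by positivity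
    linarith
  have hM : 0 ≤ M := (norm_nonneg a).trans ha
  calc |‖a‖ ^ p - ‖a - b‖ ^ p| ≤ p * (‖a‖ + ‖b‖) ^ (p - 1) * |‖a‖ - ‖a - b‖| := h1
    _ ≤ p * ((2 * M) ^ (p - 2) * (‖a‖ + ‖b‖)) * ‖b‖ := by gcongr
    _ = p * (2 * M) ^ (p - 2) * ((‖a‖ + ‖b‖) * ‖b‖) := by ring
    _ ≤ _ := by gcongr

end Powers

/-! ### Weak compactness on an edge -/

section EdgeLimits
variable {𝕜 : Type*} [RCLike 𝕜]

theorem tendsto_integral_norm_rpow {ι : Type*} {l : Filter ι} {ℓ p : ℝ} (hp : 1 ≤ p)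
    {v : ι → ℝ → 𝕜} {w : ℝ → 𝕜} (hv : ∀ i, ContinuousOn (v i) (Icc 0 ℓ))
    (hw : ContinuousOn w (Icc 0 ℓ)) (h : TendstoUniformlyOn v w l (Icc 0 ℓ)) :
    Tendsto (fun i => ∫ x in Ioo 0 ℓ, ‖v i x‖ ^ p) l (𝓝 (∫ x in Ioo 0 ℓ, ‖w x‖ ^ p)) := by
  obtain ⟨M, hM⟩ := isCompact_Icc.exists_bound_of_continuousOn hw
  have hint : ∀ {z : ℝ → 𝕜}, ContinuousOn z (Icc 0 ℓ) →
      IntegrableOn (fun x => ‖z x‖ ^ p) (Ioo 0 ℓ) := fun {z} hz =>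
    ((hz.norm.rpow_const fun x _ => Or.inr (by linarith)).integrableOn_compact
      isCompact_Icc).mono_set Ioo_subset_Icc_self
  rw [Metric.tendsto_nhds]
  intro ε hε
  set Q := p * (|M| + 1) ^ (p - 1) * volume.real (Ioo (0 : ℝ) ℓ) with hQ
  have hQ0 : 0 ≤ Q := by positivity
  have hδ : 0 < min 1 (ε / (Q + 1)) := by positivity
  rw [Metric.tendstoUniformlyOn_iff] at h
  filter_upwards [h _ hδ] with i hi
  rw [Real.dist_eq, ← integral_sub (hint (hv i)) (hint hw)]
  have hb : ‖∫ x in Ioo 0 ℓ, (‖v i x‖ ^ p - ‖w x‖ ^ p)‖ ≤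
      p * (|M| + 1) ^ (p - 1) * (ε / (Q + 1)) * volume.real (Ioo (0 : ℝ) ℓ) := by
    refine norm_setIntegral_le_of_norm_le_const (by simp) fun x hx => ?_
    have hx' := Ioo_subset_Icc_self hx
    have hd := hi x hx'
    rw [dist_comm, dist_eq_norm] at hd
    have h1 : ‖w x‖ ≤ |M| + 1 := by linarith [hM x hx', le_abs_self M]
    have h2 : |‖v i x‖ - ‖w x‖| < min 1 (ε / (Q + 1)) := (abs_norm_sub_norm_le _ _).trans_lt hd
    have h3 : ‖v i x‖ ≤ |M| + 1 := by
      linarith [hM x hx', le_abs_self M, le_abs_self (‖v i x‖ - ‖w x‖),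
        h2.trans_le (min_le_left _ _)]
    rw [Real.norm_eq_abs]
    refine (abs_rpow_sub_rpow_le hp (norm_nonneg _) (norm_nonneg _) h3 h1).trans ?_
    gcongr
    exact h2.le.trans (min_le_right _ _)
  rw [Real.norm_eq_abs] at hb
  calc _ ≤ _ := hb
    _ = Q * (ε / (Q + 1)) := by rw [hQ]; ring
    _ < ε := by
      rw [mul_div_assoc', div_lt_iff₀ (by positivity)]
      nlinarith

/-- Weak compactness on an edge: along an ultrafilter, a bounded family in `H¹(0, ℓ)` converges
uniformly, its derivatives converge weakly, and their squared norms split accordingly. -/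
theorem EdgeH1.exists_limit {ι : Type*} (U : Ultrafilter ι) {ℓ : ℝ}
    {u g : ι → ℝ → 𝕜} (h : ∀ i, EdgeH1 ℓ (u i) (g i)) {K M : ℝ}
    (hK : ∀ i, ∫ x in Ioo 0 ℓ, ‖g i x‖ ^ 2 ≤ K) (hM : ∀ i, ‖u i 0‖ ≤ M) :
    ∃ w k : ℝ → 𝕜, EdgeH1 ℓ w k ∧ TendstoUniformlyOn u w U (Icc 0 ℓ) ∧
      Tendsto (fun i => (∫ x in Ioo 0 ℓ, ‖g i x‖ ^ 2) - ∫ x in Ioo 0 ℓ, ‖g i x - k x‖ ^ 2) U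
        (𝓝 (∫ x in Ioo 0 ℓ, ‖k x‖ ^ 2)) := by
  obtain ⟨z, hz⟩ := exists_tendsto_inner_of_norm_le (𝕜 := 𝕜) U
    (y := fun i => (h i).memLp.toLp (g i)) (K := √K) fun i => by
      refine Real.le_sqrt_of_sq_le ?_
      rw [norm_toLp_sq]; exact hK i
  obtain ⟨c, hc⟩ := exists_tendsto_of_norm_le U hM
  have hzm : MemLp z 2 (edgeMeasure ℓ) := Lp.memLp z
  have hw : EdgeH1 ℓ (fun x => c + ∫ t in (0 : ℝ)..x, z t) z := ⟨hzm, fun x _ => by simp⟩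
  refine ⟨fun x => c + ∫ t in (0 : ℝ)..x, z t, z, hw, ?_, ?_⟩
  · have hpt : ∀ x ∈ Icc 0 ℓ, Tendsto (fun i => u i x) U (𝓝 (c + ∫ t in (0 : ℝ)..x, z t)) := by
      intro x hx
      have hμ : edgeMeasure ℓ (Ioo 0 x) ≠ ⊤ := (measure_lt_top _ _).ne
      have e : ∀ {f : ℝ → 𝕜} (F : Lp 𝕜 2 (edgeMeasure ℓ)), F =ᵐ[edgeMeasure ℓ] f →
          starRingEnd 𝕜 (inner 𝕜 F (indicatorConstLp 2 measurableSet_Ioo hμ (1 : 𝕜))) =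
            ∫ t in (0 : ℝ)..x, f t := fun {f} F hF => by
        have h2 : (edgeMeasure ℓ).restrict (Ioo 0 x) = volume.restrict (Ioo 0 x) := by
          rw [Measure.restrict_restrict measurableSet_Ioo,
            inter_eq_left.mpr (Ioo_subset_Ioo le_rfl hx.2)]
        rw [inner_conj_symm, L2.inner_indicatorConstLp_one,
          intervalIntegral.integral_of_le hx.1, integral_Ioc_eq_integral_Ioo, ← h2]
        exact integral_congr_ae (ae_restrict_of_ae hF)
      have h1 := (RCLike.continuous_conj.tendsto _).comp
        (hz (indicatorConstLp 2 measurableSet_Ioo hμ (1 : 𝕜)))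
      rw [e z (ae_eq_refl _)] at h1
      refine (hc.add h1).congr fun i => ?_
      rw [(h i).eq_primitive x hx, Function.comp_apply, e _ (h i).memLp.coeFn_toLp]
    -- By Morrey's inequality the family is equicontinuous, so pointwise convergence is uniform.
    have heq : EquicontinuousOn u (Icc 0 ℓ) := by
      intro x hx V hV
      obtain ⟨ε, hε, hεV⟩ := Metric.mem_uniformity_dist.mp hV
      have hcont : Continuous fun y : ℝ => √|y - x| * √K := by fun_prop
      have h0 := (hcont.tendsto x).mono_left (nhdsWithin_le_nhds (s := Icc 0 ℓ))
      simp only [sub_self, abs_zero, Real.sqrt_zero, zero_mul] at h0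
      filter_upwards [h0.eventually (gt_mem_nhds hε), self_mem_nhdsWithin] with y hy hyI i
      refine hεV ?_
      rw [dist_comm, dist_eq_norm]
      refine ((h i).norm_sub_le hx hyI).trans_lt (lt_of_le_of_lt ?_ hy)
      gcongr
      exact hK i
    have hiff := EquicontinuousOn.tendsto_uniformOnFun_iff_pi' (𝔖 := {Icc 0 ℓ})
      (by simpa using isCompact_Icc) (by simpa using heq) U
      (fun x => c + ∫ t in (0 : ℝ)..x, z t)
    refine (UniformOnFun.tendsto_iff_tendstoUniformlyOn.mp (hiff.mpr ?_)) _ rfl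
    rw [tendsto_pi_nhds]
    rintro ⟨x, hx⟩
    rw [sUnion_singleton] at hx
    exact hpt x hx
  · have e : ∀ i, (∫ x in Ioo 0 ℓ, ‖g i x‖ ^ 2) - ∫ x in Ioo 0 ℓ, ‖g i x - z x‖ ^ 2 =
        2 * RCLike.re (inner 𝕜 ((h i).memLp.toLp (g i)) z) - ‖z‖ ^ 2 := fun i => by
      have h1 : ∫ x in Ioo 0 ℓ, ‖g i x - z x‖ ^ 2 = ‖(h i).memLp.toLp (g i) - z‖ ^ 2 := by
        have := norm_toLp_sq ((h i).memLp.sub hzm)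
        rw [MemLp.toLp_sub (h i).memLp hzm, Lp.toLp_coeFn z hzm] at this
        exact this.symm
      rw [h1, ← norm_toLp_sq (h i).memLp, @norm_sub_sq 𝕜]
      ring
    have h2 := (((RCLike.continuous_re.tendsto _).comp (hz z)).const_mul 2).sub_const (‖z‖ ^ 2)
    have h3 : ∫ x in Ioo 0 ℓ, ‖z x‖ ^ 2 = 2 * RCLike.re (inner 𝕜 z z) - ‖z‖ ^ 2 := by
      rw [inner_self_eq_norm_sq, ← norm_toLp_sq hzm, Lp.toLp_coeFn]
      ring
    rw [h3]
    exact h2.congr fun i => (e i).symm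

end EdgeLimits

/-! ### The space `H¹` of a metric graph, and weak limits in it -/

section Graph
variable {𝕜 : Type*} [RCLike 𝕜] {G : MetricGraph}

theorem integral_norm_sub_sq_le {α : Type*} {m : MeasurableSpace α} {ν : Measure α} {f g : α → 𝕜}
    (hf : MemLp f 2 ν) (hg : MemLp g 2 ν) :
    ∫ x, ‖f x - g x‖ ^ 2 ∂ν ≤ 2 * ∫ x, ‖f x‖ ^ 2 ∂ν + 2 * ∫ x, ‖g x‖ ^ 2 ∂ν := by
  have hf' := hf.norm.integrable_sq
  have hg' := hg.norm.integrable_sq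
  rw [← integral_const_mul, ← integral_const_mul,
    ← integral_add (hf'.const_mul 2) (hg'.const_mul 2)]
  refine integral_mono (hf.sub hg).norm.integrable_sq ((hf'.const_mul 2).add (hg'.const_mul 2))
    fun x => ?_
  have h1 := norm_sub_le (f x) (g x)
  have h2 : ‖f x - g x‖ ^ 2 ≤ (‖f x‖ + ‖g x‖) ^ 2 := by gcongr
  simp only
  nlinarith [sq_nonneg (‖f x‖ - ‖g x‖)]

/-- `u` belongs to `H¹(G)`, with derivative `g`. In contrast to `MetricGraph.MemH1`, which refers to
a chosen representative of the weak derivative, `g` may be any representative, so that the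
derivatives of sums and limits are explicit. -/
structure GraphH1 (G : MetricGraph) (u g : G.E → ℝ → 𝕜) : Prop where
  edge : ∀ e, EdgeH1 (G.len e) (u e) (g e)
  vertex : ∃ w : G.V → 𝕜, ∀ e, u e 0 = w (G.src e) ∧ u e (G.len e) = w (G.tgt e)
  summable : Summable fun e => ∫ x in Ioo 0 (G.len e), ‖u e x‖ ^ 2
  summable_deriv : Summable fun e => ∫ x in Ioo 0 (G.len e), ‖g e x‖ ^ 2

/-- `∫_G |u|^p`. -/
def powerIntegral (G : MetricGraph) (p : ℝ) (u : G.E → ℝ → 𝕜) : ℝ :=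
  G.integral fun e x => ‖u e x‖ ^ p

theorem powerIntegral_two (u : G.E → ℝ → 𝕜) : powerIntegral G 2 u = G.mass u := by
  simp only [powerIntegral, MetricGraph.mass, Real.rpow_two]

theorem mass_nonneg (u : G.E → ℝ → 𝕜) : 0 ≤ G.mass u :=
  tsum_nonneg fun _ => integral_nonneg fun _ => by positivity

theorem powerIntegral_nonneg (p : ℝ) (u : G.E → ℝ → 𝕜) : 0 ≤ powerIntegral G p u :=
  tsum_nonneg fun _ => integral_nonneg fun _ => by positivity

theorem mass_const_mul (c : 𝕜) (u : G.E → ℝ → 𝕜) :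
    G.mass (fun e x => c * u e x) = ‖c‖ ^ 2 * G.mass u := by
  simp only [MetricGraph.mass, MetricGraph.integral, norm_mul, mul_pow, integral_const_mul,
    tsum_mul_left]

theorem powerIntegral_const_mul (p : ℝ) (c : 𝕜) (u : G.E → ℝ → 𝕜) :
    powerIntegral G p (fun e x => c * u e x) = ‖c‖ ^ p * powerIntegral G p u := by
  simp only [powerIntegral, MetricGraph.integral, norm_mul,
    Real.mul_rpow (norm_nonneg _) (norm_nonneg _), integral_const_mul, tsum_mul_left]

theorem MetricGraph.MemH1.graphH1 {u : G.E → ℝ → 𝕜} (h : G.MemH1 u) :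
    GraphH1 G u fun e => weakDeriv (G.len e) (u e) :=
  ⟨fun e => .of_isWeakDeriv (G.len_pos e) (h.continuousOn e) (h.weak e) (h.memLp_deriv e),
    h.vertex, h.summable, h.summable_deriv⟩

namespace GraphH1
variable {u g v k : G.E → ℝ → 𝕜}

theorem weakDeriv_ae_eq (h : GraphH1 G u g) (e : G.E) :
    weakDeriv (G.len e) (u e) =ᵐ[edgeMeasure (G.len e)] g e :=
  (isWeakDeriv_weakDeriv (h.edge e).isWeakDeriv).ae_eq (h.edge e).isWeakDeriv

theorem integral_weakDeriv (h : GraphH1 G u g) (e : G.E) :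
    ∫ x in Ioo 0 (G.len e), ‖weakDeriv (G.len e) (u e) x‖ ^ 2 =
      ∫ x in Ioo 0 (G.len e), ‖g e x‖ ^ 2 := by
  refine integral_congr_ae ?_
  filter_upwards [h.weakDeriv_ae_eq e] with x hx
  rw [hx]

theorem memH1 (h : GraphH1 G u g) : G.MemH1 u where
  continuousOn e := (h.edge e).continuousOn
  vertex := h.vertex
  weak e := isWeakDeriv_weakDeriv (h.edge e).isWeakDeriv
  memLp e := (h.edge e).memLp_self
  memLp_deriv e := (memLp_congr_ae (h.weakDeriv_ae_eq e)).mpr (h.edge e).memLp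
  summable := h.summable
  summable_deriv := by simpa only [h.integral_weakDeriv] using h.summable_deriv

theorem energy_eq (h : GraphH1 G u g) (p : ℝ) :
    G.energy p u = 1 / 2 * G.mass g - 1 / p * powerIntegral G p u := by
  simp only [MetricGraph.energy, MetricGraph.mass, MetricGraph.integral, powerIntegral,
    h.integral_weakDeriv]

theorem sub (hu : GraphH1 G u g) (hv : GraphH1 G v k) :
    GraphH1 G (fun e x => u e x - v e x) (fun e x => g e x - k e x) := by
  refine ⟨fun e => (hu.edge e).sub (G.len_pos e).le (hv.edge e), ?_, ?_, ?_⟩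
  · obtain ⟨a, ha⟩ := hu.vertex
    obtain ⟨b, hb⟩ := hv.vertex
    exact ⟨fun x => a x - b x, fun e => by simp only [(ha e).1, (ha e).2, (hb e).1, (hb e).2,
      and_self]⟩
  · exact Summable.of_nonneg_of_le (fun e => integral_nonneg fun x => by positivity)
      (fun e => integral_norm_sub_sq_le (hu.edge e).memLp_self (hv.edge e).memLp_self)
      ((hu.summable.mul_left 2).add (hv.summable.mul_left 2))
  · exact Summable.of_nonneg_of_le (fun e => integral_nonneg fun x => by positivity)
      (fun e => integral_norm_sub_sq_le (hu.edge e).memLp (hv.edge e).memLp)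
      ((hu.summable_deriv.mul_left 2).add (hv.summable_deriv.mul_left 2))

theorem const_mul (c : 𝕜) (hu : GraphH1 G u g) :
    GraphH1 G (fun e x => c * u e x) (fun e x => c * g e x) := by
  refine ⟨fun e => (hu.edge e).const_mul c, ?_, ?_, ?_⟩
  · obtain ⟨a, ha⟩ := hu.vertex
    exact ⟨fun x => c * a x, fun e => by simp only [(ha e).1, (ha e).2, and_self]⟩
  · simpa only [norm_mul, mul_pow, integral_const_mul] using hu.summable.mul_left (‖c‖ ^ 2)
  · simpa only [norm_mul, mul_pow, integral_const_mul] using hu.summable_deriv.mul_left (‖c‖ ^ 2)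

/-- The Sobolev inequality on a graph with edges of equal length. -/
theorem norm_le {ℓ : ℝ} (hlen : ∀ e, G.len e = ℓ) (h : GraphH1 G u g) (e : G.E) {x : ℝ}
    (hx : x ∈ Icc 0 (G.len e)) : ‖u e x‖ ≤ √(G.mass u / ℓ) + √ℓ * √(G.mass g) := by
  have hℓ : 0 < ℓ := hlen e ▸ G.len_pos e
  refine ((h.edge e).norm_le (G.len_pos e) hx).trans ?_
  have h1 : ∫ x in Ioo 0 (G.len e), ‖u e x‖ ^ 2 ≤ G.mass u :=
    h.summable.le_tsum e fun _ _ => integral_nonneg fun _ => by positivity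
  have h2 : ∫ x in Ioo 0 (G.len e), ‖g e x‖ ^ 2 ≤ G.mass g :=
    h.summable_deriv.le_tsum e fun _ _ => integral_nonneg fun _ => by positivity
  rw [hlen e] at h1 h2 ⊢
  gcongr

theorem integral_rpow_le {p M : ℝ} (hp : 2 ≤ p) (h : GraphH1 G u g) (e : G.E)
    (hM : ∀ x ∈ Icc 0 (G.len e), ‖u e x‖ ≤ M) :
    ∫ x in Ioo 0 (G.len e), ‖u e x‖ ^ p ≤ M ^ (p - 2) * ∫ x in Ioo 0 (G.len e), ‖u e x‖ ^ 2 := by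
  rw [← integral_const_mul]
  refine setIntegral_mono_on ((h.edge e).integrableOn_rpow (by linarith))
    ((h.edge e).integrableOn_sq.const_mul _) measurableSet_Ioo fun x hx => ?_
  have h1 := hM x (Ioo_subset_Icc_self hx)
  rcases (norm_nonneg (u e x)).eq_or_lt with h0 | h0
  · rw [← h0, Real.zero_rpow (by linarith)]; simp
  · rw [show p = (p - 2) + 2 by ring, Real.rpow_add h0, Real.rpow_two, add_sub_cancel_right]
    gcongr

theorem summable_rpow {p M : ℝ} (hp : 2 ≤ p) (h : GraphH1 G u g)
    (hM : ∀ e, ∀ x ∈ Icc 0 (G.len e), ‖u e x‖ ≤ M) :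
    Summable fun e => ∫ x in Ioo 0 (G.len e), ‖u e x‖ ^ p :=
  Summable.of_nonneg_of_le (fun _ => integral_nonneg fun _ => by positivity)
    (fun e => h.integral_rpow_le hp e (hM e)) (h.summable.mul_left _)

theorem powerIntegral_le {p M : ℝ} (hp : 2 ≤ p) (h : GraphH1 G u g)
    (hM : ∀ e, ∀ x ∈ Icc 0 (G.len e), ‖u e x‖ ≤ M) :
    powerIntegral G p u ≤ M ^ (p - 2) * G.mass u := by
  rw [powerIntegral, MetricGraph.mass, MetricGraph.integral, MetricGraph.integral, ← tsum_mul_left]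
  exact (h.summable_rpow hp hM).tsum_le_tsum (fun e => h.integral_rpow_le hp e (hM e))
    (h.summable.mul_left _)

end GraphH1

theorem abs_integral_rpow_sub_le {ℓ p C η : ℝ} {f b : ℝ → 𝕜}
    (hf : IntegrableOn (fun x => ‖f x‖ ^ p) (Ioo 0 ℓ))
    (hfb : IntegrableOn (fun x => ‖f x - b x‖ ^ p) (Ioo 0 ℓ))
    (hf2 : IntegrableOn (fun x => ‖f x‖ ^ 2) (Ioo 0 ℓ))
    (hb2 : IntegrableOn (fun x => ‖b x‖ ^ 2) (Ioo 0 ℓ))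
    (h : ∀ x ∈ Ioo 0 ℓ, |‖f x‖ ^ p - ‖f x - b x‖ ^ p| ≤
      C * (η * ‖f x‖ ^ 2 + (1 / η + 1) * ‖b x‖ ^ 2)) :
    |(∫ x in Ioo 0 ℓ, ‖f x‖ ^ p) - ∫ x in Ioo 0 ℓ, ‖f x - b x‖ ^ p| ≤
      C * (η * (∫ x in Ioo 0 ℓ, ‖f x‖ ^ 2) + (1 / η + 1) * ∫ x in Ioo 0 ℓ, ‖b x‖ ^ 2) := by
  rw [← integral_sub hf hfb]
  refine abs_integral_le_integral_abs.trans ?_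
  rw [← integral_const_mul, ← integral_const_mul (1 / η + 1),
    ← integral_add (hf2.const_mul _) (hb2.const_mul _), ← integral_const_mul]
  exact setIntegral_mono_on (hf.sub hfb).abs
    (((hf2.const_mul _).add (hb2.const_mul _)).const_mul _) measurableSet_Ioo h

/-- Compactness and splitting. Along an ultrafilter, a bounded family in `H¹(G)` has a weak limit
in `H¹(G)`; the convergence is uniform on each edge, and subtracting the limit takes away its share
of the kinetic energy and of all the power integrals. -/
theorem GraphH1.exists_limit {ι : Type*} (U : Ultrafilter ι) {ℓ : ℝ} (hlen : ∀ e, G.len e = ℓ)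
    {u g : ι → G.E → ℝ → 𝕜} (h : ∀ i, GraphH1 G (u i) (g i)) {m K : ℝ}
    (hm : ∀ i, G.mass (u i) ≤ m) (hK : ∀ i, G.mass (g i) ≤ K) :
    ∃ w k : G.E → ℝ → 𝕜, GraphH1 G w k ∧
      (∀ e, TendstoUniformlyOn (fun i => u i e) (w e) U (Icc 0 (G.len e))) ∧
      Tendsto (fun i => G.mass (g i) - G.mass fun e x => g i e x - k e x) U (𝓝 (G.mass k)) ∧
      ∀ p, 2 ≤ p → Tendsto
        (fun i => powerIntegral G p (u i) - powerIntegral G p fun e x => u i e x - w e x) U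
        (𝓝 (powerIntegral G p w)) := by
  set M : ℝ := √(m / ℓ) + √ℓ * √K with hMdef
  have hM : ∀ i e, ∀ x ∈ Icc 0 (G.len e), ‖u i e x‖ ≤ M := fun i e x hx => by
    have hℓ : 0 < ℓ := hlen e ▸ G.len_pos e
    refine ((h i).norm_le hlen e hx).trans ?_
    rw [hMdef]
    have := hm i
    have := hK i
    gcongr
  have hm' : ∀ i (T : Finset G.E), ∑ e ∈ T, ∫ x in Ioo 0 (G.len e), ‖u i e x‖ ^ 2 ≤ m :=
    fun i T => ((h i).summable.sum_le_tsum T fun _ _ => integral_nonneg fun _ => by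
      positivity).trans (hm i)
  have hK' : ∀ i (T : Finset G.E), ∑ e ∈ T, ∫ x in Ioo 0 (G.len e), ‖g i e x‖ ^ 2 ≤ K :=
    fun i T => ((h i).summable_deriv.sum_le_tsum T fun _ _ => integral_nonneg fun _ => by
      positivity).trans (hK i)
  choose w k hwk hunif hsplit using fun e => EdgeH1.exists_limit U
    (fun i => (h i).edge e) (K := K) (M := M) (fun i => by simpa using hK' i {e})
    (fun i => hM i e 0 (left_mem_Icc.mpr (G.len_pos e).le))
  have hpt : ∀ e, ∀ x ∈ Icc 0 (G.len e), Tendsto (fun i => u i e x) U (𝓝 (w e x)) :=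
    fun e x hx => (hunif e).tendsto_at hx
  have hpow : ∀ e {p : ℝ}, 1 ≤ p → Tendsto (fun i => ∫ x in Ioo 0 (G.len e), ‖u i e x‖ ^ p) U
      (𝓝 (∫ x in Ioo 0 (G.len e), ‖w e x‖ ^ p)) := fun e p hp =>
    tendsto_integral_norm_rpow hp (fun i => ((h i).edge e).continuousOn) (hwk e).continuousOn
      (hunif e)
  have hpow' : ∀ e {p : ℝ}, 1 ≤ p →
      Tendsto (fun i => ∫ x in Ioo 0 (G.len e), ‖u i e x - w e x‖ ^ p) U (𝓝 0) := fun e p hp => by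
    have h0 : TendstoUniformlyOn (fun i x => u i e x - w e x) (fun _ => (0 : 𝕜)) U
        (Icc 0 (G.len e)) := by
      have := hunif e
      rw [Metric.tendstoUniformlyOn_iff] at this ⊢
      intro ε hε
      filter_upwards [this ε hε] with i hi x hx
      rw [dist_zero_left, norm_sub_rev, ← dist_eq_norm]
      exact hi x hx
    have := tendsto_integral_norm_rpow hp
      (fun i => ((h i).edge e).continuousOn.sub (hwk e).continuousOn) continuousOn_const h0
    simpa [Real.zero_rpow (show p ≠ 0 by linarith)] using this
  have hlim : GraphH1 G w k := by
    refine ⟨hwk, ?_, ?_, ?_⟩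
    -- At a vertex without edges the values need not converge, and `limUnder` is arbitrary.
    · choose a ha using fun i => (h i).vertex
      refine ⟨fun x => limUnder (U : Filter ι) fun i => a i x, fun e => ⟨?_, ?_⟩⟩
      · refine (Tendsto.limUnder_eq ?_).symm
        exact (hpt e 0 (left_mem_Icc.mpr (G.len_pos e).le)).congr fun i => (ha i e).1
      · refine (Tendsto.limUnder_eq ?_).symm
        exact (hpt e _ (right_mem_Icc.mpr (G.len_pos e).le)).congr fun i => (ha i e).2
    · refine summable_of_sum_le (c := m) (fun e => integral_nonneg fun _ => by positivity)
        fun T => ?_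
      refine le_of_tendsto' (x := (U : Filter ι))
        (f := fun i => ∑ e ∈ T, ∫ x in Ioo 0 (G.len e), ‖u i e x‖ ^ 2)
        (tendsto_finsetSum T fun e _ => ?_) fun i => hm' i T
      simpa only [Real.rpow_two] using hpow e one_le_two
    · refine summable_of_sum_le (c := K) (fun e => integral_nonneg fun _ => by positivity)
        fun T => ?_
      refine le_of_tendsto' (x := (U : Filter ι)) (tendsto_finsetSum T fun e _ => hsplit e)
        fun i => ?_
      refine le_trans (Finset.sum_le_sum fun e _ => ?_) (hK' i T)
      exact sub_le_self _ (integral_nonneg fun _ => by positivity)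
  have hMw : ∀ e, ∀ x ∈ Icc 0 (G.len e), ‖w e x‖ ≤ M := fun e x hx =>
    le_of_tendsto' (hpt e x hx).norm fun i => hM i e x hx
  have hMd : ∀ i e, ∀ x ∈ Icc 0 (G.len e), ‖u i e x - w e x‖ ≤ M + M := fun i e x hx =>
    (norm_sub_le _ _).trans (add_le_add (hM i e x hx) (hMw e x hx))
  have hd : ∀ i, GraphH1 G (fun e x => u i e x - w e x) fun e x => g i e x - k e x :=
    fun i => (h i).sub hlim
  refine ⟨w, k, hlim, hunif, ?_, fun p hp => ?_⟩
  · have key := tendsto_tsum_of_forall_exists_abs_le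
      (A := fun i e => ∫ x in Ioo 0 (G.len e), ‖g i e x‖ ^ 2)
      (fun i e => integral_nonneg fun _ => by positivity) (fun i => (h i).summable_deriv) hK
      hlim.summable_deriv hlim.summable_deriv hsplit
      fun η hη => ⟨2 * (1 / (η / 2) + 1), fun i e => ?_⟩
    · refine key.congr fun i => ?_
      exact (h i).summable_deriv.tsum_sub (hd i).summable_deriv
    · have e1 := ((h i).edge e).memLp.norm.integrable_sq
      have e2 := (hwk e).memLp.norm.integrable_sq
      have e3 := ((hd i).edge e).memLp.norm.integrable_sq
      have := abs_integral_rpow_sub_le (p := 2) (C := 2) (η := η / 2) (f := g i e) (b := k e)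
        (by simpa only [Real.rpow_two, IntegrableOn] using e1)
        (by simpa only [Real.rpow_two, IntegrableOn] using e3) e1 e2
        fun x _ => by
          have := abs_norm_rpow_sub_norm_sub_rpow_le le_rfl (half_pos hη)
            (le_max_left ‖g i e x‖ ‖k e x‖) (le_max_right ‖g i e x‖ ‖k e x‖)
          rwa [sub_self, Real.rpow_zero, mul_one] at this
      simp only [Real.rpow_two] at this
      linarith
  · have hC : 0 ≤ p * (2 * M) ^ (p - 2) := by
      have : 0 ≤ M := by positivity
      positivity
    have key := tendsto_tsum_of_forall_exists_abs_le
      (s := fun i e => (∫ x in Ioo 0 (G.len e), ‖u i e x‖ ^ p) -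
        ∫ x in Ioo 0 (G.len e), ‖u i e x - w e x‖ ^ p)
      (A := fun i e => ∫ x in Ioo 0 (G.len e), ‖u i e x‖ ^ 2)
      (fun i e => integral_nonneg fun _ => by positivity) (fun i => (h i).summable) hm
      hlim.summable (hlim.summable_rpow hp hMw)
      (fun e => by simpa using (hpow e (p := p) (by linarith)).sub (hpow' e (by linarith)))
      fun η hη => ?_
    · refine key.congr fun i => ?_
      exact ((h i).summable_rpow hp (hM i)).tsum_sub ((hd i).summable_rpow hp (hMd i))
    · set C := p * (2 * M) ^ (p - 2) with hCdef
      -- `C + 1` instead of `C`, which may vanish.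
      refine ⟨C * (1 / (η / (C + 1)) + 1), fun i e => ?_⟩
      have := abs_integral_rpow_sub_le (p := p) (C := C) (η := η / (C + 1)) (f := u i e) (b := w e)
        (((h i).edge e).integrableOn_rpow (by linarith))
        (((hd i).edge e).integrableOn_rpow (by linarith))
        ((h i).edge e).integrableOn_sq (hwk e).integrableOn_sq fun x hx =>
          abs_norm_rpow_sub_norm_sub_rpow_le hp (by positivity) (hM i e x (Ioo_subset_Icc_self hx))
            (hMw e x (Ioo_subset_Icc_self hx))
      refine this.trans ?_
      rw [mul_add, ← mul_assoc, ← mul_assoc]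
      have h0 : 0 ≤ ∫ x in Ioo 0 (G.len e), ‖u i e x‖ ^ 2 :=
        integral_nonneg fun _ => by positivity
      gcongr
      rw [mul_div_assoc', div_le_iff₀ (by positivity)]
      nlinarith

end Graph

/-! ### Existence of ground states on periodic graphs -/

section Existence
variable {𝕜 : Type*} [RCLike 𝕜] {G : MetricGraph}

/-- A power of exponent less than `2` of an affine function is dominated by a small quadratic. -/
theorem exists_mul_rpow_le_sq {a b c r : ℝ} (ha : 0 ≤ a) (hb : 0 ≤ b) (hc : 0 ≤ c) (hr : 0 ≤ r)
    (hr2 : r < 2) : ∃ C, ∀ s, 0 ≤ s → c * (a + b * s) ^ r ≤ s ^ 2 / 4 + C := by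
  -- With this `δ`, and `(a + b s)² ≤ 2 a² + 2 b² s²`, the bound `t ^ r ≤ δ t² + T ^ r` suffices.
  set δ : ℝ := 1 / (8 * (c * b ^ 2 + 1)) with hδdef
  have hδ : 0 < δ := by positivity
  obtain ⟨T, hT1, hT⟩ := ((eventually_ge_atTop (1 : ℝ)).and (eventually_forall_ge_atTop.mpr
    ((tendsto_rpow_neg_atTop (show 0 < 2 - r by linarith)).eventually (ge_mem_nhds hδ)))).exists
  refine ⟨c * δ * (2 * a ^ 2) + c * T ^ r, fun s hs => ?_⟩
  have ht0 : 0 ≤ a + b * s := by positivity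
  have h1 : (a + b * s) ^ r ≤ δ * (a + b * s) ^ 2 + T ^ r := by
    rcases le_total (a + b * s) T with h | h
    · have h2 : (a + b * s) ^ r ≤ T ^ r := Real.rpow_le_rpow ht0 h hr
      have h3 : 0 ≤ δ * (a + b * s) ^ 2 := by positivity
      linarith
    · have hpos : 0 < a + b * s := by linarith
      have h2 := hT _ h
      have h3 : (a + b * s) ^ r = (a + b * s) ^ (-(2 - r)) * (a + b * s) ^ 2 := by
        rw [← Real.rpow_two, ← Real.rpow_add hpos]
        congr 1; ring
      have h4 : 0 ≤ T ^ r := by positivity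
      rw [h3]
      have : (a + b * s) ^ (-(2 - r)) * (a + b * s) ^ 2 ≤ δ * (a + b * s) ^ 2 := by gcongr
      linarith
  have h2 : (a + b * s) ^ 2 ≤ 2 * a ^ 2 + 2 * (b ^ 2 * s ^ 2) := by
    nlinarith [sq_nonneg (a - b * s)]
  have h3 : c * δ * (2 * (b ^ 2 * s ^ 2)) ≤ s ^ 2 / 4 := by
    have h4 : c * b ^ 2 * δ ≤ 1 / 8 := by
      rw [hδdef, mul_one_div, div_le_div_iff₀ (by positivity) (by norm_num)]
      nlinarith
    nlinarith [sq_nonneg s]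
  calc c * (a + b * s) ^ r ≤ c * (δ * (2 * a ^ 2 + 2 * (b ^ 2 * s ^ 2)) + T ^ r) := by
        gcongr
        exact h1.trans (by gcongr)
    _ = c * δ * (2 * (b ^ 2 * s ^ 2)) + (c * δ * (2 * a ^ 2) + c * T ^ r) := by ring
    _ ≤ _ := by gcongr

/-- Coercivity of the energy on functions of bounded mass. By the Sobolev inequality the potential
term grows at most like `‖u'‖₂ ^ (p - 2)`, an exponent less than `2`. -/
theorem exists_le_energy {ℓ p μ : ℝ} (hlen : ∀ e, G.len e = ℓ) (hp2 : 2 < p) (hp4 : p < 4)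
    (hμ : 0 ≤ μ) :
    ∃ C, ∀ u g : G.E → ℝ → 𝕜, GraphH1 G u g → G.mass u ≤ μ →
      G.mass g / 4 - C ≤ G.energy p u := by
  obtain ⟨C, hC⟩ := exists_mul_rpow_le_sq (a := √(μ / ℓ)) (b := √ℓ) (c := 1 / p * μ)
    (r := p - 2) (by positivity) (by positivity) (by positivity) (by linarith) (by linarith)
  refine ⟨C, fun u g h hm => ?_⟩
  have h1 := hC (√(G.mass g)) (Real.sqrt_nonneg _)
  rw [Real.sq_sqrt (mass_nonneg g)] at h1
  have h2 := h.powerIntegral_le hp2.le (M := √(μ / ℓ) + √ℓ * √(G.mass g)) fun e x hx => by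
    have hℓ : 0 < ℓ := hlen e ▸ G.len_pos e
    refine (h.norm_le hlen e hx).trans ?_
    gcongr
  have h3 : 1 / p * powerIntegral G p u ≤
      1 / p * μ * (√(μ / ℓ) + √ℓ * √(G.mass g)) ^ (p - 2) := by
    have : powerIntegral G p u ≤ (√(μ / ℓ) + √ℓ * √(G.mass g)) ^ (p - 2) * μ :=
      h2.trans (by gcongr)
    calc _ ≤ 1 / p * ((√(μ / ℓ) + √ℓ * √(G.mass g)) ^ (p - 2) * μ) := by gcongr
      _ = _ := by ring
  rw [h.energy_eq]
  linarith

/-- Since `p > 2`, raising the mass by a factor `θ ≥ 1` scales the energy at least as favourably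
as linearly. -/
theorem GraphH1.energy_sqrt_mul_le {p θ : ℝ} (hp : 2 ≤ p) (hθ : 1 ≤ θ) {u g : G.E → ℝ → 𝕜}
    (h : GraphH1 G u g) :
    G.energy p (fun e x => ((√θ : ℝ) : 𝕜) * u e x) ≤ θ * G.energy p u := by
  have hn : ‖((√θ : ℝ) : 𝕜)‖ = √θ := by
    rw [RCLike.norm_ofReal, abs_of_nonneg (Real.sqrt_nonneg θ)]
  rw [(h.const_mul _).energy_eq, h.energy_eq, mass_const_mul, powerIntegral_const_mul, hn,
    Real.sq_sqrt (by linarith)]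
  have h1 : θ ≤ √θ ^ p := by
    calc θ = √θ ^ (2 : ℝ) := by rw [Real.rpow_two, Real.sq_sqrt (by linarith)]
      _ ≤ √θ ^ p := Real.rpow_le_rpow_of_exponent_le (Real.one_le_sqrt.mpr hθ) hp
  have h2 := mul_le_mul_of_nonneg_right h1
    (mul_nonneg (show 0 ≤ 1 / p by positivity) (powerIntegral_nonneg p u))
  linarith

theorem mass_sqrt_mul {θ : ℝ} (hθ : 0 ≤ θ) (u : G.E → ℝ → 𝕜) :
    G.mass (fun e x => ((√θ : ℝ) : 𝕜) * u e x) = θ * G.mass u := by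
  rw [mass_const_mul, RCLike.norm_ofReal, abs_of_nonneg (Real.sqrt_nonneg θ), Real.sq_sqrt hθ]

/-- A lower bound `I` for the energy at mass `μ` yields one at all smaller masses, by scaling up to
mass `μ`. -/
theorem GraphH1.mul_le_energy {ℓ p μ I : ℝ} (hlen : ∀ e, G.len e = ℓ) (hp : 2 ≤ p) (hμ : 0 < μ)
    (hI : ∀ v : G.E → ℝ → 𝕜, G.MemH1 v → G.mass v = μ → I ≤ G.energy p v)
    {u g : G.E → ℝ → 𝕜} (h : GraphH1 G u g) (hm : G.mass u ≤ μ) :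
    G.mass u / μ * I ≤ G.energy p u := by
  rcases (mass_nonneg u).eq_or_lt with h0 | h0
  · have h1 := h.powerIntegral_le hp fun e x hx => h.norm_le hlen e hx
    rw [← h0, mul_zero] at h1
    have h2 : powerIntegral G p u = 0 := le_antisymm h1 (powerIntegral_nonneg p u)
    rw [← h0, zero_div, zero_mul, h.energy_eq, h2]
    linarith [mass_nonneg g]
  · have hθ : 1 ≤ μ / G.mass u := (one_le_div h0).mpr hm
    have h1 := hI _ (h.const_mul ((√(μ / G.mass u) : ℝ) : 𝕜)).memH1 (by
      rw [mass_sqrt_mul (by positivity), div_mul_cancel₀ _ h0.ne'])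
    have h2 := h1.trans (h.energy_sqrt_mul_le hp hθ)
    rw [div_mul_eq_mul_div, div_le_iff₀ hμ]
    rw [div_mul_eq_mul_div, le_div_iff₀ h0] at h2
    linarith

theorem integral_comp_perm {σ : Equiv.Perm G.E} (hlen : ∀ e, G.len (σ e) = G.len e)
    (f : G.E → ℝ → ℝ) : G.integral (fun e => f (σ e)) = G.integral f := by
  rw [MetricGraph.integral, MetricGraph.integral,
    ← σ.tsum_eq fun e => ∫ x in Ioo 0 (G.len e), f e x]
  simp only [hlen]

/-- Invariance under automorphisms of the graph. -/
theorem GraphH1.comp_perm {σ : Equiv.Perm G.E} {τ : G.V → G.V}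
    (hlen : ∀ e, G.len (σ e) = G.len e) (hsrc : ∀ e, G.src (σ e) = τ (G.src e))
    (htgt : ∀ e, G.tgt (σ e) = τ (G.tgt e)) {u g : G.E → ℝ → 𝕜} (h : GraphH1 G u g) :
    GraphH1 G (fun e => u (σ e)) fun e => g (σ e) := by
  refine ⟨fun e => hlen e ▸ h.edge (σ e), ?_, ?_, ?_⟩
  · obtain ⟨w, hw⟩ := h.vertex
    exact ⟨fun x => w (τ x), fun e => by dsimp only; rw [← hsrc, ← htgt, ← hlen e]; exact hw (σ e)⟩
  · have := (σ.summable_iff (f := fun e => ∫ x in Ioo 0 (G.len e), ‖u e x‖ ^ 2)).mpr h.summable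
    simpa only [Function.comp_def, hlen] using this
  · have := (σ.summable_iff (f := fun e => ∫ x in Ioo 0 (G.len e), ‖g e x‖ ^ 2)).mpr
      h.summable_deriv
    simpa only [Function.comp_def, hlen] using this

theorem GraphH1.eqOn_zero_of_mass_eq_zero {u g : G.E → ℝ → 𝕜} (h : GraphH1 G u g)
    (h0 : G.mass u = 0) (e : G.E) : EqOn (u e) 0 (Icc 0 (G.len e)) := by
  have h1 : ∫ x in Ioo 0 (G.len e), ‖u e x‖ ^ 2 ≤ G.mass u :=
    h.summable.le_tsum e fun _ _ => integral_nonneg fun _ => by positivity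
  rw [h0] at h1
  have h2 : ∫ x in Ioo 0 (G.len e), ‖u e x‖ ^ 2 = 0 :=
    le_antisymm h1 (integral_nonneg fun _ => by positivity)
  rw [integral_eq_zero_iff_of_nonneg (fun _ => by positivity) (h.edge e).integrableOn_sq] at h2
  have hc := (h.edge e).continuousOn
  have h3 : EqOn (u e) 0 (Ioo 0 (G.len e)) := by
    refine Measure.eqOn_open_of_ae_eq (μ := volume) ?_ isOpen_Ioo
      (hc.mono Ioo_subset_Icc_self) continuousOn_const
    filter_upwards [h2] with x hx
    simpa using hx
  exact h3.of_subset_closure hc continuousOn_const Ioo_subset_Icc_self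
    (by rw [closure_Ioo (G.len_pos e).ne])

/-- A graph with edges of equal length, on whose edges the automorphisms act with finitely many
orbits, has a ground state of mass `μ` as soon as some function of mass `μ` has negative energy. -/
theorem exists_isGroundState {ℓ p μ : ℝ} (hlen : ∀ e, G.len e = ℓ) (T : Finset G.E)
    (hsymm : ∀ e, ∃ σ : Equiv.Perm G.E, ∃ τ : G.V → G.V, (∀ e', G.src (σ e') = τ (G.src e')) ∧
      (∀ e', G.tgt (σ e') = τ (G.tgt e')) ∧ ∃ f ∈ T, σ f = e)
    (hp2 : 2 < p) (hp4 : p < 4) (hμ : 0 < μ)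
    (hneg : ∃ v : G.E → ℝ → 𝕜, G.MemH1 v ∧ G.mass v = μ ∧ G.energy p v < 0) :
    ∃ u : G.E → ℝ → 𝕜, G.IsGroundState p μ u := by
  obtain ⟨v₀, hv₀, hv₀m, hv₀E⟩ := hneg
  obtain ⟨C, hC⟩ := exists_le_energy (𝕜 := 𝕜) hlen hp2 hp4 hμ.le
  set S : Set ℝ := {E | ∃ v : G.E → ℝ → 𝕜, G.MemH1 v ∧ G.mass v = μ ∧ G.energy p v = E} with hS
  have hSne : S.Nonempty := ⟨_, v₀, hv₀, hv₀m, rfl⟩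
  have hSb : BddBelow S := ⟨-C, by
    rintro _ ⟨v, hv, hvm, rfl⟩
    linarith [hC v _ hv.graphH1 hvm.le, mass_nonneg (G := G) fun e => weakDeriv (G.len e) (v e)]⟩
  set I := sInf S with hIdef
  have hI : ∀ v : G.E → ℝ → 𝕜, G.MemH1 v → G.mass v = μ → I ≤ G.energy p v :=
    fun v hv hm => csInf_le hSb ⟨v, hv, hm, rfl⟩
  have hI0 : I < 0 := (hI v₀ hv₀ hv₀m).trans_lt hv₀E
  -- A function of mass `μ` and energy below `I / 2` exceeds the value `δ` somewhere.
  set δ : ℝ := (p * (-I / 2) / μ) ^ (1 / (p - 2)) with hδdef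
  have hδarg : 0 < p * (-I / 2) / μ := by
    have : 0 < -I / 2 := by linarith
    positivity
  have hδ : 0 < δ := Real.rpow_pos_of_pos hδarg _
  have hδp : δ ^ (p - 2) * μ = p * (-I / 2) := by
    rw [hδdef, ← Real.rpow_mul hδarg.le, one_div_mul_cancel (by linarith), Real.rpow_one,
      div_mul_cancel₀ _ hμ.ne']
  have hseq : ∀ n : ℕ, ∃ u g : G.E → ℝ → 𝕜, GraphH1 G u g ∧ G.mass u = μ ∧
      G.energy p u < I + 1 / ((n : ℝ) + 1) ∧ G.energy p u < I / 2 ∧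
      ∃ f ∈ T, ∃ x ∈ Icc 0 (G.len f), δ < ‖u f x‖ := by
    intro n
    have hlt : sInf S < min (I + 1 / ((n : ℝ) + 1)) (I / 2) := by
      rw [← hIdef]
      refine lt_min ?_ (by linarith)
      have : 0 < 1 / ((n : ℝ) + 1) := by positivity
      linarith
    obtain ⟨_, ⟨v, hv, hvm, rfl⟩, hvE⟩ := exists_lt_of_csInf_lt hSne hlt
    have hvg := hv.graphH1
    have hlarge : ∃ e, ∃ x ∈ Icc 0 (G.len e), δ < ‖v e x‖ := by
      by_contra! hcon
      have h1 := hvg.powerIntegral_le hp2.le hcon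
      rw [hvm, hδp] at h1
      have h2 : 1 / p * powerIntegral G p v ≤ 1 / p * (p * (-I / 2)) := by gcongr
      rw [← mul_assoc, one_div_mul_cancel (by linarith), one_mul] at h2
      have h3 := hvE.trans_le (min_le_right _ _)
      rw [hvg.energy_eq] at h3
      linarith [mass_nonneg (G := G) fun e => weakDeriv (G.len e) (v e)]
    obtain ⟨e, x, hx, hδx⟩ := hlarge
    obtain ⟨σ, τ, hsrc, htgt, f, hf, hfe⟩ := hsymm e
    have hlen' : ∀ e, G.len (σ e) = G.len e := fun e => by rw [hlen, hlen]
    have hcomp := hvg.comp_perm hlen' hsrc htgt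
    have hE : G.energy p (fun e => v (σ e)) = G.energy p v := by
      rw [hcomp.energy_eq, hvg.energy_eq]
      congr 2
      · exact integral_comp_perm hlen' fun e x => ‖weakDeriv (G.len e) (v e) x‖ ^ 2
      · exact integral_comp_perm hlen' fun e x => ‖v e x‖ ^ p
    refine ⟨_, _, hcomp, ?_, ?_, ?_, f, hf, x, ?_, ?_⟩
    · exact (integral_comp_perm hlen' fun e x => ‖v e x‖ ^ 2).trans hvm
    · rw [hE]; exact hvE.trans_le (min_le_left _ _)
    · rw [hE]; exact hvE.trans_le (min_le_right _ _)
    · rwa [← hlen', hfe]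
    · rwa [hfe]
  choose u g hug hum huE huE' hbig using hseq
  let U : Ultrafilter ℕ := Ultrafilter.of atTop
  have hU : (U : Filter ℕ) ≤ atTop := Ultrafilter.of_le atTop
  obtain ⟨w, k, hwk, hunif, hkin, hpow⟩ := GraphH1.exists_limit U hlen hug (m := μ) (K := 4 * C)
    (fun n => (hum n).le) fun n => by linarith [hC _ _ (hug n) (hum n).le, huE' n]
  have hE : Tendsto (fun n => G.energy p (u n)) U (𝓝 I) := by
    have h1 : Tendsto (fun n : ℕ => I + 1 / ((n : ℝ) + 1)) atTop (𝓝 (I + 0)) :=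
      tendsto_const_nhds.add tendsto_one_div_add_atTop_nhds_zero_nat
    rw [add_zero] at h1
    exact tendsto_of_tendsto_of_tendsto_of_le_of_le tendsto_const_nhds (h1.mono_left hU)
      (fun n => hI _ (hug n).memH1 (hum n)) fun n => (huE n).le
  -- The limit is not zero, because the functions of the sequence exceed `δ` on an edge in `T`.
  have hm0 : 0 < G.mass w := by
    refine (mass_nonneg w).lt_of_ne fun h0 => ?_
    have hw0 := hwk.eqOn_zero_of_mass_eq_zero h0.symm
    have hev : ∀ᶠ n in (U : Filter ℕ), ∀ f ∈ T, ∀ x ∈ Icc 0 (G.len f), ‖u n f x‖ < δ := by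
      rw [eventually_all_finset]
      intro f _
      filter_upwards [Metric.tendstoUniformlyOn_iff.mp (hunif f) δ hδ] with n hn x hx
      have := hn x hx
      rwa [hw0 f hx, Pi.zero_apply, dist_zero_left] at this
    obtain ⟨n, hn⟩ := hev.exists
    obtain ⟨f, hf, x, hx, hlt⟩ := hbig n
    exact lt_asymm hlt (hn f hf x hx)
  -- The remainders `u n - w` carry, in the limit, the rest of the mass and of the energy.
  have hd : ∀ n, GraphH1 G (fun e x => u n e x - w e x) fun e x => g n e x - k e x :=
    fun n => (hug n).sub hwk
  have hmass : Tendsto (fun n => G.mass fun e x => u n e x - w e x) U (𝓝 (μ - G.mass w)) := by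
    have := (hpow 2 le_rfl).const_sub μ
    simp only [powerIntegral_two, hum, sub_sub_cancel] at this
    exact this
  have hEd : Tendsto (fun n => G.energy p fun e x => u n e x - w e x) U
      (𝓝 (I - G.energy p w)) := by
    have := hE.sub ((hkin.const_mul (1 / 2)).sub ((hpow p hp2.le).const_mul (1 / p)))
    rw [hwk.energy_eq]
    refine this.congr fun n => ?_
    rw [(hd n).energy_eq, (hug n).energy_eq]
    ring
  have hmle : G.mass w ≤ μ :=
    sub_nonneg.mp (ge_of_tendsto' hmass fun n => mass_nonneg _)
  have hlow : (μ - G.mass w) / μ * I ≤ I - G.energy p w := by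
    refine le_of_tendsto_of_tendsto ((hmass.div_const μ).mul_const I) hEd ?_
    filter_upwards [hmass.eventually (ge_mem_nhds (show μ - G.mass w < μ by linarith))] with n hn
    exact (hd n).mul_le_energy hlen hp2.le hμ hI hn
  have hwE : G.energy p w ≤ G.mass w / μ * I := by
    have : (μ - G.mass w) / μ * I = I - G.mass w / μ * I := by field_simp
    linarith
  have hθ : 1 ≤ μ / G.mass w := (one_le_div hm0).mpr hmle
  refine ⟨fun e x => ((√(μ / G.mass w) : ℝ) : 𝕜) * w e x, ⟨(hwk.const_mul _).memH1, ?_⟩,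
    fun v hv hvm => le_trans ?_ (hI v hv hvm)⟩
  · rw [mass_sqrt_mul (by positivity), div_mul_cancel₀ _ hm0.ne']
  · refine (hwk.energy_sqrt_mul_le hp2.le hθ).trans ?_
    calc μ / G.mass w * G.energy p w ≤ μ / G.mass w * (G.mass w / μ * I) := by gcongr
      _ = I := by field_simp

end Existence

/-! ### Functions that are affine on each edge -/

section AffineExtension
variable {𝕜 : Type*} [RCLike 𝕜] {G : MetricGraph}

/-- The function on `G` with the values `f` at the vertices that is affine on each edge. -/
def affineExtension (𝕜 : Type*) [RCLike 𝕜] (G : MetricGraph) (f : G.V → ℝ) : G.E → ℝ → 𝕜 :=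
  fun e x => ((f (G.src e) + x * ((f (G.tgt e) - f (G.src e)) / G.len e) : ℝ) : 𝕜)

/-- The derivative of `affineExtension 𝕜 G f`. -/
def affineSlope (𝕜 : Type*) [RCLike 𝕜] (G : MetricGraph) (f : G.V → ℝ) : G.E → ℝ → 𝕜 :=
  fun e _ => (((f (G.tgt e) - f (G.src e)) / G.len e : ℝ) : 𝕜)

theorem le_affineExtension {f : G.V → ℝ} {e : G.E} {a x : ℝ} (hx : x ∈ Icc 0 (G.len e))
    (hs : a ≤ f (G.src e)) (ht : a ≤ f (G.tgt e)) :
    a ≤ f (G.src e) + x * ((f (G.tgt e) - f (G.src e)) / G.len e) := by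
  have h1 : 0 ≤ x / G.len e := div_nonneg hx.1 (G.len_pos e).le
  have h2 : x / G.len e ≤ 1 := (div_le_one (G.len_pos e)).mpr hx.2
  have h3 : f (G.src e) + x * ((f (G.tgt e) - f (G.src e)) / G.len e) =
      (1 - x / G.len e) * f (G.src e) + x / G.len e * f (G.tgt e) := by ring
  rw [h3]
  nlinarith [mul_le_mul_of_nonneg_left hs (sub_nonneg.mpr h2), mul_le_mul_of_nonneg_left ht h1]

theorem affineExtension_le {f : G.V → ℝ} {e : G.E} {a x : ℝ} (hx : x ∈ Icc 0 (G.len e))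
    (hs : f (G.src e) ≤ a) (ht : f (G.tgt e) ≤ a) :
    f (G.src e) + x * ((f (G.tgt e) - f (G.src e)) / G.len e) ≤ a := by
  have := le_affineExtension (f := fun v => -f v) (a := -a) hx (neg_le_neg hs) (neg_le_neg ht)
  have h3 : -f (G.src e) + x * ((-f (G.tgt e) - -f (G.src e)) / G.len e) =
    -(f (G.src e) + x * ((f (G.tgt e) - f (G.src e)) / G.len e)) := by ring
  rw [h3] at this
  exact neg_le_neg_iff.mp this

variable {f : G.V → ℝ} {T : Finset G.E}

theorem integral_affineExtension_eq_zero (hT : ∀ e ∉ T, f (G.src e) = 0 ∧ f (G.tgt e) = 0) {p : ℝ}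
    (hp : p ≠ 0) (e : G.E) (he : e ∉ T) :
    ∫ x in Ioo 0 (G.len e), ‖affineExtension 𝕜 G f e x‖ ^ p = 0 := by
  simp [affineExtension, hT e he, Real.zero_rpow hp]

theorem integral_affineSlope_eq_zero (hT : ∀ e ∉ T, f (G.src e) = 0 ∧ f (G.tgt e) = 0) (e : G.E)
    (he : e ∉ T) : ∫ x in Ioo 0 (G.len e), ‖affineSlope 𝕜 G f e x‖ ^ 2 = 0 := by
  simp [affineSlope, hT e he]

theorem graphH1_affineExtension (hT : ∀ e ∉ T, f (G.src e) = 0 ∧ f (G.tgt e) = 0) :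
    GraphH1 G (affineExtension 𝕜 G f) (affineSlope 𝕜 G f) where
  edge e := ⟨memLp_const _, fun x _ => by
    simp only [affineExtension, affineSlope, zero_mul, add_zero, intervalIntegral.integral_const,
      sub_zero, RCLike.real_smul_eq_coe_mul]
    rw [← RCLike.ofReal_mul, ← RCLike.ofReal_add]⟩
  vertex := ⟨fun v => (f v : 𝕜), fun e => by
    have := (G.len_pos e).ne'
    simp only [affineExtension, zero_mul, add_zero, mul_div_cancel₀ _ this, add_sub_cancel,
      and_self]⟩
  summable := summable_of_ne_finset_zero (s := T) fun e he => by
    simpa using integral_affineExtension_eq_zero (𝕜 := 𝕜) hT two_ne_zero e he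
  summable_deriv := summable_of_ne_finset_zero (s := T) (integral_affineSlope_eq_zero hT)

theorem powerIntegral_affineExtension_le (hT : ∀ e ∉ T, f (G.src e) = 0 ∧ f (G.tgt e) = 0)
    {ℓ p a : ℝ} (hlen : ∀ e, G.len e = ℓ) (hp : 0 < p) (hf0 : ∀ v, 0 ≤ f v) (hfa : ∀ v, f v ≤ a) :
    powerIntegral G p (affineExtension 𝕜 G f) ≤ T.card * (ℓ * a ^ p) := by
  rw [powerIntegral, MetricGraph.integral,
    tsum_eq_sum (integral_affineExtension_eq_zero hT hp.ne'), ← nsmul_eq_mul]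
  refine Finset.sum_le_card_nsmul _ _ _ fun e _ => ?_
  have h1 : ∫ x in Ioo 0 (G.len e), ‖affineExtension 𝕜 G f e x‖ ^ p ≤
      ∫ _ in Ioo 0 (G.len e), a ^ p := by
    refine setIntegral_mono_on (((graphH1_affineExtension hT).edge e).integrableOn_rpow hp.le)
      (integrableOn_const (by simp)) measurableSet_Ioo fun x hx => ?_
    have hx' := Ioo_subset_Icc_self hx
    rw [affineExtension, RCLike.norm_ofReal,
      abs_of_nonneg (le_affineExtension hx' (hf0 _) (hf0 _))]
    exact Real.rpow_le_rpow (le_affineExtension hx' (hf0 _) (hf0 _))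
      (affineExtension_le hx' (hfa _) (hfa _)) hp.le
  rw [setIntegral_const, smul_eq_mul, Real.volume_real_Ioo_of_le (G.len_pos e).le, sub_zero] at h1
  simpa only [hlen] using h1

theorem le_powerIntegral_affineExtension (hT : ∀ e ∉ T, f (G.src e) = 0 ∧ f (G.tgt e) = 0)
    {ℓ p a : ℝ} (hlen : ∀ e, G.len e = ℓ) (hp : 0 < p) (ha : 0 ≤ a) {T' : Finset G.E}
    (hf : ∀ e ∈ T', a ≤ f (G.src e) ∧ a ≤ f (G.tgt e)) :
    T'.card * (ℓ * a ^ p) ≤ powerIntegral G p (affineExtension 𝕜 G f) := by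
  have hsum : Summable fun e => ∫ x in Ioo 0 (G.len e), ‖affineExtension 𝕜 G f e x‖ ^ p :=
    summable_of_ne_finset_zero (s := T) (integral_affineExtension_eq_zero hT hp.ne')
  refine le_trans ?_ (hsum.sum_le_tsum T' fun _ _ => integral_nonneg fun _ => by positivity)
  rw [← nsmul_eq_mul]
  refine Finset.card_nsmul_le_sum _ _ _ fun e he => ?_
  have h1 : ∫ _ in Ioo 0 (G.len e), a ^ p ≤
      ∫ x in Ioo 0 (G.len e), ‖affineExtension 𝕜 G f e x‖ ^ p := by
    refine setIntegral_mono_on (integrableOn_const (by simp))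
      (((graphH1_affineExtension hT).edge e).integrableOn_rpow hp.le) measurableSet_Ioo
      fun x hx => ?_
    have h2 := le_affineExtension (Ioo_subset_Icc_self hx) (hf e he).1 (hf e he).2
    rw [affineExtension, RCLike.norm_ofReal, abs_of_nonneg (ha.trans h2)]
    exact Real.rpow_le_rpow ha h2 hp.le
  rw [setIntegral_const, smul_eq_mul, Real.volume_real_Ioo_of_le (G.len_pos e).le, sub_zero] at h1
  simpa only [hlen] using h1

theorem mass_affineSlope_le (hT : ∀ e ∉ T, f (G.src e) = 0 ∧ f (G.tgt e) = 0)
    {ℓ : ℝ} (hlen : ∀ e, G.len e = ℓ) (hf : ∀ e, |f (G.tgt e) - f (G.src e)| ≤ 1) :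
    G.mass (affineSlope 𝕜 G f) ≤ T.card * ℓ⁻¹ := by
  rw [MetricGraph.mass, MetricGraph.integral, tsum_eq_sum (integral_affineSlope_eq_zero hT),
    ← nsmul_eq_mul]
  refine Finset.sum_le_card_nsmul _ _ _ fun e _ => ?_
  have hℓ : 0 < ℓ := hlen e ▸ G.len_pos e
  simp only [affineSlope, RCLike.norm_ofReal, sq_abs]
  rw [setIntegral_const, smul_eq_mul, Real.volume_real_Ioo_of_le (G.len_pos e).le, sub_zero, hlen,
    div_pow, ← sq_abs]
  calc ℓ * (|f (G.tgt e) - f (G.src e)| ^ 2 / ℓ ^ 2) ≤ ℓ * (1 ^ 2 / ℓ ^ 2) := by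
        gcongr
        exact hf e
    _ = ℓ⁻¹ := by field_simp

end AffineExtension

/-! ### The honeycomb -/

section Honeycomb
variable {𝕜 : Type*} [RCLike 𝕜] {ℓ : ℝ} {hℓ : 0 < ℓ}

/-- The edges that start in a cell with coordinates at most `n` in absolute value. -/
def edgeBox (n : ℕ) : Finset (ℤ × ℤ × Fin 3) :=
  Finset.Icc (-n : ℤ) n ×ˢ Finset.Icc (-n : ℤ) n ×ˢ Finset.univ

theorem card_edgeBox (n : ℕ) : (edgeBox n).card = 3 * (2 * n + 1) ^ 2 := by
  have h : (n + 1 - -n : ℤ).toNat = 2 * n + 1 := by omega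
  simp only [edgeBox, Finset.card_product, Int.card_Icc, Finset.card_univ, Fintype.card_fin, h]
  ring

theorem mem_edgeBox {n : ℕ} {e : ℤ × ℤ × Fin 3} :
    e ∈ edgeBox n ↔ e.1.natAbs ≤ n ∧ e.2.1.natAbs ≤ n := by
  simp only [edgeBox, Finset.mem_product, Finset.mem_Icc, Finset.mem_univ, and_true]
  omega

/-- The vertex function that decreases linearly from `N` at the cell of the origin to `0`. The
subtraction is the truncated one of `ℕ`, which cuts the function off at `0`. -/
def tent (N : ℕ) (v : ℤ × ℤ × Bool) : ℝ := ((N - max v.1.natAbs v.2.1.natAbs : ℕ) : ℝ)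

theorem natAbs_tgt_sub_src (e : (honeycomb ℓ hℓ).E) :
    (((honeycomb ℓ hℓ).tgt e).1 - e.1).natAbs ≤ 1 ∧
      (((honeycomb ℓ hℓ).tgt e).2.1 - e.2.1).natAbs ≤ 1 := by
  obtain ⟨i, j, k⟩ := e
  fin_cases k <;> simp

theorem tent_eq_zero (N : ℕ) (e : (honeycomb ℓ hℓ).E) (he : e ∉ edgeBox N) :
    tent N ((honeycomb ℓ hℓ).src e) = 0 ∧ tent N ((honeycomb ℓ hℓ).tgt e) = 0 := by
  have h := natAbs_tgt_sub_src e
  generalize (honeycomb ℓ hℓ).tgt e = t at h ⊢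
  rw [mem_edgeBox] at he
  simp only [tent, Nat.cast_eq_zero]
  omega

theorem abs_tent_sub_le (N : ℕ) (e : (honeycomb ℓ hℓ).E) :
    |tent N ((honeycomb ℓ hℓ).tgt e) - tent N ((honeycomb ℓ hℓ).src e)| ≤ 1 := by
  have h := natAbs_tgt_sub_src e
  generalize (honeycomb ℓ hℓ).tgt e = t at h ⊢
  simp only [tent]
  rw [abs_sub_le_iff, sub_le_iff_le_add, sub_le_iff_le_add]
  norm_cast
  omega

theorem le_tent (M : ℕ) (e : (honeycomb ℓ hℓ).E) (he : e ∈ edgeBox M) :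
    (M : ℝ) ≤ tent (2 * M + 1) ((honeycomb ℓ hℓ).src e) ∧
      (M : ℝ) ≤ tent (2 * M + 1) ((honeycomb ℓ hℓ).tgt e) := by
  have h := natAbs_tgt_sub_src e
  generalize (honeycomb ℓ hℓ).tgt e = t at h ⊢
  rw [mem_edgeBox] at he
  simp only [tent]
  norm_cast
  omega

/-- Below the exponent `4 = 2 + 4 / d`, critical in dimension `d = 2`, the energy takes negative
values at every mass. -/
theorem exists_energy_neg {p μ : ℝ} (hp2 : 2 < p) (hp4 : p < 4) (hμ : 0 < μ) :
    ∃ v : (honeycomb ℓ hℓ).E → ℝ → 𝕜, (honeycomb ℓ hℓ).MemH1 v ∧ (honeycomb ℓ hℓ).mass v = μ ∧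
      (honeycomb ℓ hℓ).energy p v < 0 := by
  set G := honeycomb ℓ hℓ with hG
  -- The test function is a multiple of the tent of height `2 M + 1 ≤ 3 M`, supported on
  -- `3 (4 M + 3)² ≤ 147 M²` edges; so its mass, before scaling, is at most `1323 ℓ M⁴`.
  -- Potential and kinetic term are compared up to the common factor `θ M²`, which leaves
  -- `c₁ M ^ (4 - p)` against a constant.
  set c₁ : ℝ := (μ / (1323 * ℓ)) ^ ((p - 2) / 2) * ℓ / p with hc₁
  have hc₁0 : 0 < c₁ := by positivity
  obtain ⟨M, hM1, hM⟩ := ((eventually_ge_atTop 1).and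
    (((tendsto_rpow_atTop (show 0 < 4 - p by linarith)).comp
      tendsto_natCast_atTop_atTop).eventually
        (eventually_gt_atTop (147 * ℓ⁻¹ / 2 / c₁)))).exists
  rw [Function.comp_apply, div_lt_iff₀ hc₁0] at hM
  have hM1' : (1 : ℝ) ≤ M := by exact_mod_cast hM1
  have hM0 : (0 : ℝ) < M := by linarith
  have hlen : ∀ e, G.len e = ℓ := fun _ => rfl
  have hT := tent_eq_zero (hℓ := hℓ) (2 * M + 1)
  have hH := graphH1_affineExtension (𝕜 := 𝕜) (G := G) hT
  have hcard : ((edgeBox (2 * M + 1)).card : ℝ) ≤ 147 * M ^ 2 := by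
    rw [card_edgeBox]; push_cast; nlinarith
  have hcard' : (M : ℝ) ^ 2 ≤ ((edgeBox M).card : ℝ) := by
    rw [card_edgeBox]; push_cast; nlinarith
  set u := affineExtension 𝕜 G (tent (2 * M + 1)) with hu
  have hQ : G.mass u ≤ 1323 * ℓ * M ^ 4 := by
    have := powerIntegral_affineExtension_le (𝕜 := 𝕜) (G := G) hT hlen two_pos (a := 3 * M)
      (fun v => by simp only [tent]; positivity) fun v => by
        have h1 : 2 * M + 1 - max v.1.natAbs v.2.1.natAbs ≤ 3 * M := by omega
        simp only [tent]; exact_mod_cast h1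
    rw [powerIntegral_two, Real.rpow_two] at this
    calc G.mass u ≤ _ := this
      _ ≤ 147 * M ^ 2 * (ℓ * (3 * M) ^ 2) := by gcongr
      _ = _ := by ring
  have hQ0 : 0 < G.mass u := by
    have := le_powerIntegral_affineExtension (𝕜 := 𝕜) (G := G) hT hlen two_pos hM0.le (le_tent M)
    rw [powerIntegral_two] at this
    refine lt_of_lt_of_le ?_ this
    have : (0 : ℝ) < (edgeBox M).card := lt_of_lt_of_le (by positivity) hcard'
    positivity
  have hP : (M : ℝ) ^ 2 * (ℓ * M ^ p) ≤ powerIntegral G p u :=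
    le_trans (by gcongr) (le_powerIntegral_affineExtension (𝕜 := 𝕜) (G := G) hT hlen
      (by linarith) hM0.le (le_tent M))
  have hK : G.mass (affineSlope 𝕜 G (tent (2 * M + 1))) ≤ 147 * M ^ 2 * ℓ⁻¹ :=
    (mass_affineSlope_le hT hlen (abs_tent_sub_le _)).trans (by gcongr)
  set θ := μ / G.mass u with hθ
  have hθ0 : 0 < θ := by positivity
  refine ⟨_, (hH.const_mul ((√θ : ℝ) : 𝕜)).memH1, ?_, ?_⟩
  · rw [mass_sqrt_mul hθ0.le, div_mul_cancel₀ _ hQ0.ne']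
  rw [(hH.const_mul _).energy_eq, mass_const_mul, powerIntegral_const_mul, RCLike.norm_ofReal,
    abs_of_nonneg (Real.sqrt_nonneg θ), Real.sq_sqrt hθ0.le]
  have h1 : √θ ^ p = θ * θ ^ ((p - 2) / 2) := by
    rw [Real.sqrt_eq_rpow, ← Real.rpow_mul hθ0.le, ← Real.rpow_one_add' hθ0.le (by linarith)]
    congr 1; ring
  have h2 : (μ / (1323 * ℓ)) ^ ((p - 2) / 2) * (M : ℝ) ^ (-(2 * (p - 2))) ≤
      θ ^ ((p - 2) / 2) := by
    have h3 : (M : ℝ) ^ (-(2 * (p - 2))) = ((M : ℝ) ^ (-4 : ℝ)) ^ ((p - 2) / 2) := by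
      rw [← Real.rpow_mul hM0.le]; congr 1; ring
    rw [h3, ← Real.mul_rpow (by positivity) (by positivity)]
    refine Real.rpow_le_rpow (by positivity) ?_ (by linarith)
    rw [Real.rpow_neg hM0.le, show (M : ℝ) ^ (4 : ℝ) = (M : ℝ) ^ 4 by norm_cast,
      ← div_eq_mul_inv, div_div]
    exact div_le_div_of_nonneg_left hμ.le hQ0 hQ
  have h4 : c₁ * (M : ℝ) ^ (4 - p) * M ^ 2 ≤ θ ^ ((p - 2) / 2) * (1 / p * powerIntegral G p u) := by
    have h5 : (M : ℝ) ^ (4 - p) = (M : ℝ) ^ (-(2 * (p - 2))) * M ^ p := by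
      rw [← Real.rpow_add hM0]; congr 1; ring
    calc c₁ * (M : ℝ) ^ (4 - p) * M ^ 2
        = ((μ / (1323 * ℓ)) ^ ((p - 2) / 2) * (M : ℝ) ^ (-(2 * (p - 2)))) *
            (1 / p * ((M : ℝ) ^ 2 * (ℓ * M ^ p))) := by rw [h5, hc₁]; ring
      _ ≤ _ := by gcongr
  have h6 : 1 / 2 * G.mass (affineSlope 𝕜 G (tent (2 * M + 1))) <
      θ ^ ((p - 2) / 2) * (1 / p * powerIntegral G p u) := by
    have h7 : 147 * ℓ⁻¹ / 2 * M ^ 2 < (M : ℝ) ^ (4 - p) * c₁ * M ^ 2 :=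
      mul_lt_mul_of_pos_right hM (by positivity)
    linarith
  rw [h1]
  nlinarith [mul_lt_mul_of_pos_left h6 hθ0]

/-- Up to translation, every edge of the honeycomb is one of the three edges at the origin. -/
theorem exists_translation (e : (honeycomb ℓ hℓ).E) :
    ∃ σ : Equiv.Perm (honeycomb ℓ hℓ).E, ∃ τ : (honeycomb ℓ hℓ).V → (honeycomb ℓ hℓ).V,
      (∀ e', (honeycomb ℓ hℓ).src (σ e') = τ ((honeycomb ℓ hℓ).src e')) ∧
      (∀ e', (honeycomb ℓ hℓ).tgt (σ e') = τ ((honeycomb ℓ hℓ).tgt e')) ∧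
      ∃ f ∈ edgeBox 0, σ f = e := by
  obtain ⟨a, b, k⟩ := e
  refine ⟨(Equiv.addRight a).prodCongr ((Equiv.addRight b).prodCongr (Equiv.refl _)),
    fun v => (v.1 + a, v.2.1 + b, v.2.2), fun _ => rfl, ?_, (0, 0, k), ?_, ?_⟩
  · rintro ⟨i, j, k'⟩
    fin_cases k' <;> simp <;> ring
  · simp [mem_edgeBox]
  · simp

end Honeycomb

end NLSGraph

end

theorem theorem1p1 {𝕜 : Type*} [RCLike 𝕜] (ℓ : ℝ) (hℓ : 0 < ℓ) (p : ℝ) (hp2 : 2 < p) (hp4 : p < 4)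
    (μ : ℝ) (hμ : 0 < μ) :
    ∃ u : (NLSGraph.honeycomb ℓ hℓ).E → ℝ → 𝕜,
      (NLSGraph.honeycomb ℓ hℓ).IsGroundState p μ u :=
  NLSGraph.exists_isGroundState (ℓ := ℓ) (fun _ => rfl) (NLSGraph.edgeBox 0)
    NLSGraph.exists_translation hp2 hp4 hμ (NLSGraph.exists_energy_neg hp2 hp4 hμ)
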